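/- **Setting.** Let $\mathcal P_2(\mathbb R^n)$ be the set of probability measures on $\mathbb R^n$ with finite second moment, $W_2$ the 2-Wasserstein distance and $\Pi_o(\mu,\nu)$ the set of optimal couplings. The Wasserstein gradient $\nabla_W\mathcal G(\mu)$ of $\mathcal G:\mathcal P_2(\mathbb R^p)\to\mathbb R$ is the element of the tangent space $T_\mu=\overline{\{\nabla\psi:\psi\in C_c^\infty\}}^{L^2(\mu)}$ that lies in both the sub- and the super-differential of $\mathcal G$ at $\mu$, where $\xi\in L^2(\mu)$ is in the sub-differential if $\mathcal G(\nu)\ge\mathcal G(\mu)+\sup_{\gamma\in\Pi_o(\mu,\nu)}\int\langle\xi(x),y-x\rangle d\gamma+o(W_2(\mu,\nu))$. The first variation $\frac{\delta U}{\delta\mu}(\mu)$ is the function $\varphi\in L^1(\mu)$ with $U(\mu+\chi)=U(\mu)+\int\varphi\,d\chi+o(s)$, uniformly over the perturbations $\chi$ of zero mass with $|\chi|\le s\mu$, as $s\to0$. Let $D:\mathcal P_2(\mathbb R^p)^2\to\mathbb R$ be a symmetric divergence ($D\ge0$, $D(\mu,\mu)=0$) that is continuous (with respect to $W_2$ in the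 first argument and to perturbations $|\nu'-\nu|\le s\nu$, $s\to0$, in the second), $F_\theta:\mathcal P_2(\mathbb R^p)\times\mathcal P_2(\mathbb R^d)\to\mathcal P_2(\mathbb R^p)$ for $\theta\in\mathbb R^w$, $\mathcal G_{\theta,\rho}(\mu)=D(\mu,F_\theta(\mu,\rho))$, and let $\mu^*_{\theta,\rho}$ be a minimizer of $\mathcal G_{\theta,\rho}$. Let $h:\mathcal P_2(\mathbb R^p)\to\mathbb R^q$ have a first variation at every $\mu$, let $\ell:\mathbb R^q\times\mathbb R^q\to\mathbb R$ be differentiable in its first argument, let $(\rho,y)\sim P$ be random in $\mathcal P_2(\mathbb R^d)\times\mathbb R^q$, and let $\mathcal L(\theta)=\mathbb E_{\rho,y}[\ell(h(\mu^*_{\theta,\rho}),y)]$, where the expectation exists and $\mathcal L$ is bounded below. Assume: 1. *(Gibbs form)* $d\mu^*_{\theta,\rho}=Z_{\theta,\rho}^{-1}e^{-V_\rho(x,\theta)}dx$ with $V_\rho:\mathbb R^p\times\mathbb R^w\to\mathbb R$ of class $C^1$ and $\|\nabla_2V_\rho(x,\theta)\|\le C_V$. 2. *(Lipschitz and bounded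 $\Gamma$)* With $\Gamma_{\rho,y}(\mu,\theta)=-\nabla_1\ell(h(\mu),y)\cdot\mathrm{Cov}_\mu\big(\frac{\delta h}{\delta\mu}(\mu)(Z),\nabla_2V_\rho(Z,\theta)\big)$, for $P$-almost every $(\rho,y)$ and all $\mu,\nu,\theta$: $\|\Gamma_{\rho,y}(\mu,\theta)-\Gamma_{\rho,y}(\nu,\theta)\|\le K_\Gamma D(\mu,\nu)$ and $\|\Gamma_{\rho,y}(\mu,\theta)\|\le C_\Gamma$. 3. *(PL inequality)* With $\mathcal F_\nu(\mu)=D(\mu,\nu)$ and $C_{PL}\ge0$: $\mathcal F_{\mu^*_{\theta,\rho}}(\mu)\le C_{PL}\|\nabla_W\mathcal F_{\mu^*_{\theta,\rho}}(\mu)\|^2_{L^2(\mu)}$ for all $\theta,\rho$ and all $\mu$ at which this Wasserstein gradient exists. Then $\mathcal L$ is differentiable and $\nabla\mathcal L(\theta)=\mathbb E_{\rho,y}[\Gamma_{\rho,y}(\mu^*_{\theta,\rho},\theta)]$. **Dynamics.** Let $\varepsilon_t=\min(1,t^{-1/2})$, let $t\mapsto\theta_t\in\mathbb R^w$ be a curve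 on $[0,\infty)$ and, for every $\rho$, let $t\mapsto\mu_{t,\rho}$ be a Wasserstein gradient flow of the functionals $\mathcal G_{\theta_t,\rho}$: a locally absolutely continuous curve in $(\mathcal P_2(\mathbb R^p),W_2)$ solving $\partial_t\mu_{t,\rho}+\mathrm{div}(\mu_{t,\rho}v_{t,\rho})=0$ in the sense of distributions where, for a.e. $t$, $v_{t,\rho}\in T_{\mu_{t,\rho}}$ and $-v_{t,\rho}$ is in the sub-differential of $\mathcal G_{\theta_t,\rho}$ at $\mu_{t,\rho}$ (so $v_{t,\rho}=-\nabla_W\mathcal G_{\theta_t,\rho}(\mu_{t,\rho})$ where that gradient exists). Assume that for all $\rho$, and for all $t\ge0$ with $D(\mu_{t,\rho},\mu^*_{\theta_t,\rho})\neq0$: * $D$ is jointly differentiable at $(\mu,\nu)=(\mu_{t,\rho},\mu^*_{\theta_t,\rho})$, i.e. there are $\xi\in T_\mu$ and $\varphi\in L^2(\nu)$ with $D(\mu',\nu')=D(\mu,\nu)+\int\langle\xi(x),y-x\rangle d\gamma+\int\varphi\,d(\nu'-\nu)+o\big((\int\|x-y\|^2d\gamma)^{1/2}+s\big)$ for all couplings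 $\gamma$ of $\mu,\mu'$ and all $\nu'$ with $|\nu'-\nu|\le s\nu$; and the first variation $\varphi$ satisfies $\|\varphi\|_{L^2(\mu^*_{\theta_t,\rho})}\le C_{\mathcal F}$; * *(gradient mismatch)* for almost every such $t$, $\|-v_{t,\rho}-\nabla_W\mathcal F_{\mu^*_{\theta_t,\rho}}(\mu_{t,\rho})\|^2_{L^2(\mu_{t,\rho})}\le M\varepsilon_t$, where $M>0$. Assume finally that $\theta$ is continuous on $[0,\infty)$ and that one of the following holds throughout $t>0$: * (a) $\frac{d\theta_t}{dt}=-\varepsilon_t\nabla\mathcal L(\theta_t)$; or * (b) $\frac{d\theta_t}{dt}=-\varepsilon_t\,\mathbb E_{\rho,y}[\Gamma_{\rho,y}(\mu_{t,\rho},\theta_t)]$ (the gradient evaluated at the current inner state), where $(\rho,y)\mapsto\Gamma_{\rho,y}(\mu_{t,\rho},\theta_t)$ is measurable and $\mathbb E_\rho[D(\mu_{0,\rho},\mu^*_{\theta_0,\rho})]<\infty$. **Theorem.** In either case, $t\mapsto\|\nabla\mathcal L(\theta_t)\|^2$ is integrable on every $[0,T]$, and for every $\delta>0$ there is a constant $c>0$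 such that for all $T>0$ with $|T-1|\ge\delta$ $$\frac1T\int_0^T\|\nabla\mathcal L(\theta_t)\|^2\,dt\le c\,\frac{(\log T)^2}{\sqrt T}.$$ -/

import Mathlib

open MeasureTheory Set Filter Topology

noncomputable section

/-- The Euclidean space of dimension `n`. -/
abbrev Euc (n : ℕ) : Type := EuclideanSpace ℝ (Fin n)

/-- Probability measures on `ℝⁿ` with finite second moment. -/
abbrev P2 (n : ℕ) : Type :=
  {μ : Measure (Euc n) // IsProbabilityMeasure μ ∧ Integrable (fun x => ‖x‖ ^ 2) μ}

section Wasserstein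

/-- `γ` is a coupling of `μ` and `ν`. -/
def IsCoupling {n : ℕ} (γ : Measure (Euc n × Euc n)) (μ ν : P2 n) : Prop :=
  γ.map Prod.fst = μ.1 ∧ γ.map Prod.snd = ν.1

/-- The quadratic transport cost `(∫ ‖x - y‖² dγ)^{1/2}` (the integrand is integrable for every
coupling of two elements of `P2 n`). -/
def transportCost {n : ℕ} (γ : Measure (Euc n × Euc n)) : ℝ :=
  Real.sqrt (∫ z, ‖z.1 - z.2‖ ^ 2 ∂γ)

/-- The 2-Wasserstein distance. -/
def W2 {n : ℕ} (μ ν : P2 n) : ℝ :=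
  sInf {c : ℝ | ∃ γ : Measure (Euc n × Euc n), IsCoupling γ μ ν ∧ c = transportCost γ}

/-- `γ` is an optimal coupling of `μ` and `ν`. -/
def IsOptimalCoupling {n : ℕ} (γ : Measure (Euc n × Euc n)) (μ ν : P2 n) : Prop :=
  IsCoupling γ μ ν ∧ transportCost γ = W2 μ ν

/-- `ξ` lies in the tangent space `T_μ P₂`, the closure in `L²(μ)` of the gradients of smooth
compactly supported functions. -/
def IsTangent {n : ℕ} (μ : P2 n) (ξ : Euc n → Euc n) : Prop :=
  MemLp ξ 2 μ.1 ∧ ∀ η : ℝ, 0 < η → ∃ ψ : Euc n → ℝ,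
    ContDiff ℝ (⊤ : ℕ∞) ψ ∧ HasCompactSupport ψ ∧
      eLpNorm (fun x => ξ x - gradient ψ x) 2 μ.1 ≤ ENNReal.ofReal η

/-- `ξ` belongs to the Wasserstein sub-differential of `G` at `μ`:
`G ν ≥ G μ + sup_{γ optimal} ∫ ⟪ξ x, y - x⟫ dγ + o(W₂(μ, ν))`. -/
def IsWSubgradient {n : ℕ} (G : P2 n → ℝ) (μ : P2 n) (ξ : Euc n → Euc n) : Prop :=
  MemLp ξ 2 μ.1 ∧ ∀ η : ℝ, 0 < η → ∃ δ : ℝ, 0 < δ ∧ ∀ ν : P2 n, W2 μ ν < δ →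
    ∀ γ : Measure (Euc n × Euc n), IsOptimalCoupling γ μ ν →
      G μ + ∫ z, inner ℝ (ξ z.1) (z.2 - z.1) ∂γ - η * W2 μ ν ≤ G ν

/-- `ξ` is the Wasserstein gradient of `G` at `μ`: it lies in the sub-differential, in the
super-differential, and in the tangent space (where it is unique). -/
def HasWGradient {n : ℕ} (G : P2 n → ℝ) (μ : P2 n) (ξ : Euc n → Euc n) : Prop :=
  IsTangent μ ξ ∧ IsWSubgradient G μ ξ ∧
    IsWSubgradient (fun ν => - G ν) μ (fun x => - ξ x)

/-- A Wasserstein gradient flow, on the time interval `[0, ∞)`, of the (possibly time dependent)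
functional `G t`: a locally absolutely continuous curve in `(P₂, W₂)` that solves the continuity
equation `∂ₜ μ + div (μ v) = 0` in the sense of distributions, where for almost every `t` the
velocity `v t` is tangent and `- v t` is a Wasserstein subgradient of `G t` at `μ t`. (Where `G t`
is Wasserstein differentiable at `μ t`, this means that `v t` is minus its Wasserstein gradient.) -/
structure IsWGradientFlow {n : ℕ} (G : ℝ → P2 n → ℝ) (μ : ℝ → P2 n)
    (v : ℝ → Euc n → Euc n) : Prop where
  absolutelyContinuous : ∃ m : ℝ → ℝ, (∀ T : ℝ, 0 ≤ T → IntervalIntegrable m volume 0 T) ∧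
    ∀ s t : ℝ, 0 ≤ s → s ≤ t → W2 (μ s) (μ t) ≤ ∫ r in s..t, m r
  velocity : ∀ᵐ t ∂(volume.restrict (Ioi (0 : ℝ))),
    IsTangent (μ t) (v t) ∧ IsWSubgradient (G t) (μ t) (fun x => - v t x)
  continuityEquation : ∀ ψ : Euc n → ℝ, ContDiff ℝ (⊤ : ℕ∞) ψ → HasCompactSupport ψ →
    ∀ t : ℝ, 0 ≤ t →
      IntervalIntegrable (fun r => ∫ x, inner ℝ (gradient ψ x) (v r x) ∂(μ r).1) volume 0 t ∧
      ∫ x, ψ x ∂(μ t).1 - ∫ x, ψ x ∂(μ 0).1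
        = ∫ r in (0 : ℝ)..t, ∫ x, inner ℝ (gradient ψ x) (v r x) ∂(μ r).1

end Wasserstein

section FirstVariation

/-- `ν' = (1 + r) ν` with a relative density `|r| ≤ s`. -/
def RelClose {n : ℕ} (s : ℝ) (ν ν' : P2 n) : Prop :=
  ENNReal.ofReal (1 - s) • ν.1 ≤ ν'.1 ∧ ν'.1 ≤ ENNReal.ofReal (1 + s) • ν.1

/-- `φ` is the first variation `δU/δμ` of `U` at `μ`: `U (μ + χ) = U μ + ∫ φ dχ + o(s)` for the
perturbations `χ` of total mass zero with `|χ| ≤ s μ`, uniformly as `s → 0`. It determines `φ`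
almost everywhere with respect to `μ`, up to an additive constant. -/
def HasFirstVariation {n : ℕ} {Y : Type*} [NormedAddCommGroup Y] [NormedSpace ℝ Y]
    (U : P2 n → Y) (μ : P2 n) (φ : Euc n → Y) : Prop :=
  Integrable φ μ.1 ∧ ∀ η : ℝ, 0 < η → ∃ δ : ℝ, 0 < δ ∧ ∀ (s : ℝ) (μ' : P2 n),
    0 ≤ s → s < δ → RelClose s μ μ' →
      ‖U μ' - U μ - (∫ x, φ x ∂μ'.1 - ∫ x, φ x ∂μ.1)‖ ≤ η * s

end FirstVariation

section Divergence

/-- A symmetric divergence. Only non-negativity and vanishing on the diagonal are asked for. -/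
structure IsSymmDivergence {n : ℕ} (D : P2 n → P2 n → ℝ) : Prop where
  nonneg : ∀ μ ν, 0 ≤ D μ ν
  self : ∀ μ, D μ μ = 0
  symm : ∀ μ ν, D μ ν = D ν μ

/-- `D` is continuous at `(μ, ν)`, for `W₂` in the first argument and for bounded relative
perturbations in the second one. -/
def DivContinuousAt {n : ℕ} (D : P2 n → P2 n → ℝ) (μ ν : P2 n) : Prop :=
  ∀ η : ℝ, 0 < η → ∃ δ : ℝ, 0 < δ ∧ ∀ (μ' ν' : P2 n) (s : ℝ),
    W2 μ μ' < δ → 0 ≤ s → s < δ → RelClose s ν ν' → |D μ' ν' - D μ ν| ≤ η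

/-- `D` is (jointly) differentiable at `(μ, ν)`: `ξ` is the Wasserstein gradient in the first
argument, `φ` is the first variation in the second argument, and
`D(μ', ν') = D(μ, ν) + ∫ ⟪ξ x, y - x⟫ dγ + ∫ φ d(ν' - ν) + o((∫ ‖x - y‖² dγ)^{1/2} + s)`
for couplings `γ` of `μ, μ'` and `|ν' - ν| ≤ s ν`. -/
def HasDivDerivAt {n : ℕ} (D : P2 n → P2 n → ℝ) (μ ν : P2 n)
    (ξ : Euc n → Euc n) (φ : Euc n → ℝ) : Prop :=
  IsTangent μ ξ ∧ MemLp φ 2 ν.1 ∧ ∀ η : ℝ, 0 < η → ∃ δ : ℝ, 0 < δ ∧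
    ∀ (μ' ν' : P2 n) (γ : Measure (Euc n × Euc n)) (s : ℝ),
      IsCoupling γ μ μ' → transportCost γ < δ → 0 ≤ s → s < δ → RelClose s ν ν' →
        |D μ' ν' - D μ ν - ∫ z, inner ℝ (ξ z.1) (z.2 - z.1) ∂γ
            - (∫ x, φ x ∂ν'.1 - ∫ x, φ x ∂ν.1)| ≤ η * (transportCost γ + s)

end Divergence

section Bilevel

variable {p d w q : ℕ}

/-- The inner objective `𝒢_{θ,ρ}(μ) = D(μ, F_θ(μ, ρ))`. -/
def innerObj (D : P2 p → P2 p → ℝ) (F : Euc w → P2 p → P2 d → P2 p)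
    (θ : Euc w) (ρ : P2 d) (μ : P2 p) : ℝ :=
  D μ (F θ μ ρ)

/-- The outer loss `ℒ(θ) = 𝔼_{(ρ,y)} [ℓ(h(μ*_{θ,ρ}), y)]`. -/
def outerLoss (P : Measure (P2 d × Euc q)) (ℓ : Euc q → Euc q → ℝ) (h : P2 p → Euc q)
    (μstar : Euc w → P2 d → P2 p) (θ : Euc w) : ℝ :=
  ∫ z, ℓ (h (μstar θ z.1)) z.2 ∂P

/-- `∇₂ V_ρ(x, θ)`. -/
def gradTheta (V : P2 d → Euc p → Euc w → ℝ) (ρ : P2 d) (θ : Euc w) (x : Euc p) : Euc w :=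
  gradient (fun θ' => V ρ x θ') θ

/-- The contraction `g · Cov_μ(a(Z), b(Z))` of the cross-covariance of `a(Z)` and `b(Z)`, `Z ∼ μ`,
with the vector `g`. -/
def contractedCov (μ : P2 p) (a : Euc p → Euc q) (b : Euc p → Euc w) (g : Euc q) : Euc w :=
  ∫ x, (inner ℝ g (a x) : ℝ) • b x ∂μ.1 - (inner ℝ g (∫ x, a x ∂μ.1) : ℝ) • ∫ x, b x ∂μ.1

/-- `Γ(μ, θ) = - ∇₁ ℓ(h(μ), y) · Cov_μ((δh/δμ)(μ)(Z), ∇₂ V_ρ(Z, θ))` for the sample `z = (ρ, y)`;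
`dh μ` is the first variation of `h` at `μ`. -/
def plugGrad (ℓ : Euc q → Euc q → ℝ) (h : P2 p → Euc q) (dh : P2 p → Euc p → Euc q)
    (V : P2 d → Euc p → Euc w → ℝ) (z : P2 d × Euc q) (μ : P2 p) (θ : Euc w) : Euc w :=
  - contractedCov μ (dh μ) (gradTheta V z.1 θ) (gradient (fun u => ℓ u z.2) (h μ))

/-- `ε_t = min(1, t^{-1/2})`, for `t > 0`. -/
def stepRatio (t : ℝ) : ℝ := min 1 (t ^ (-(1 / 2) : ℝ))

/-- `θ` is continuous on `[0, ∞)` and solves `θ'(t) = - ε_t g(t)` for `t > 0`. -/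
def SolvesOuter (θ g : ℝ → Euc w) : Prop :=
  ContinuousOn θ (Ici 0) ∧ ∀ t : ℝ, 0 < t → HasDerivAt θ (-(stepRatio t • g t)) t

/-- The rate `(1/T) ∫₀ᵀ ‖∇ℒ(θ_t)‖² dt ≤ c (log T)² / √T`, for `T > 0` bounded away from `1`
(where the right-hand side vanishes). -/
def AverageGradientRate (L : Euc w → ℝ) (θ : ℝ → Euc w) : Prop :=
  (∀ T : ℝ, 0 < T → IntervalIntegrable (fun t => ‖gradient L (θ t)‖ ^ 2) volume 0 T) ∧
  ∀ δ : ℝ, 0 < δ → ∃ c : ℝ, 0 < c ∧ ∀ T : ℝ, 0 < T → δ ≤ |T - 1| →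
    (1 / T) * ∫ t in (0 : ℝ)..T, ‖gradient L (θ t)‖ ^ 2 ≤ c * (Real.log T ^ 2 / Real.sqrt T)

end Bilevel

end

/-! The gradient formula is a differentiation under two integrals. A bounded `∇₂V` makes the Gibbs
measures at `θ` and `θ'` mutually close in relative density, at distance `O(‖θ' - θ‖)`, which is
exactly the class of perturbations tested by a first variation. So `h(μ*_θ)` has the same derivative
as the mean of `δh/δμ`, and differentiating a normalized exponential weight produces minus a
covariance. The bound on `Γ` then allows differentiation under the expectation.

For the dynamics, put `E(t) = D(μ_t, μ*_{θ_t})`. The chain rule bounds `E'` by `∫ ⟨ξ, v⟩ dμ_t` plus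
the motion of the target. The first term is at most `-½‖ξ‖² + ½‖v + ξ‖²`, so the PL inequality and
the mismatch bound give damping and an error `O(ε_t)`; the target moves at speed `O(ε_t)` as `Γ` is
bounded. Thus `E' ≤ -cE + Kε_t`, and `E` is at most an exponential plus a multiple of `(a +
t)^(-1/2)` (`div_le_exp_add_rpow_of_flow`). By the Lipschitz bound on `Γ`, the error of the outer
gradient has the same decay.

The difficulty is that `E` is not known to be absolutely continuous: the sharp slope bound holds
only almost everywhere, and at the remaining points with `E ≠ 0` there is only a growth bound with a
constant depending on the point. A Vitali–Carathéodory argument shows that this suffices for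
monotonicity, hence for comparison with a supersolution.

Finally `-ε⟨∇ℒ, g⟩ ≤ -(ε/2)‖∇ℒ‖² + (ε/2)‖g - ∇ℒ‖²`, and `ε_t` times the squared error is integrable,
being `O(t^(-3/2))` up to an exponential. So `ε_T ∫₀ᵀ ‖∇ℒ‖²` stays bounded, giving the rate `1/√T`;
away from `T = 1` the logarithm only affects the constant. -/

/-! ### Monotonicity from one-sided growth bounds. -/

section Monotonicity

/-- A continuous function which, to the right of almost every point, does not exceed its value
there is antitone, provided that to the right of every point its growth is controlled by a multiple
of the primitive of a fixed integrable function. -/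
theorem le_of_ae_eventually_le_of_forall_growth_Ico {f k : ℝ → ℝ} {a b : ℝ} (hab : a ≤ b)
    (hf : ContinuousOn f (Icc a b)) (hk : IntegrableOn k (Ioc a b)) (hk0 : ∀ t, 0 ≤ k t)
    (hae : ∀ᵐ t, t ∈ Ico a b → ∀ᶠ t' in 𝓝[>] t, f t' ≤ f t)
    (hgrow : ∀ t ∈ Ico a b, ∃ A : ℝ, ∀ᶠ t' in 𝓝[>] t, f t' - f t ≤ A * ∫ r in t..t', k r) :
    f b ≤ f a := by
  classical
  refine le_of_forall_pos_le_add fun ε εpos => ?_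
  have hgrow' : ∀ t, ∃ A : NNReal, t ∈ Ico a b →
      ∀ᶠ t' in 𝓝[>] t, f t' - f t ≤ A * ∫ r in t..t', k r := by
    intro t
    by_cases ht : t ∈ Ico a b
    · obtain ⟨A, hA⟩ := hgrow t ht
      refine ⟨A.toNNReal, fun _ => ?_⟩
      filter_upwards [hA, self_mem_nhdsWithin] with t' h1 h2
      refine h1.trans (mul_le_mul_of_nonneg_right (Real.le_coe_toNNReal A) ?_)
      exact intervalIntegral.integral_nonneg (le_of_lt h2) fun u _ => hk0 u
    · exact ⟨0, fun h => absurd h ht⟩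
  choose A hA using hgrow'
  set κ : Measure ℝ := (volume.restrict (Ioc a b)).withDensity (fun t => ENNReal.ofReal (k t))
    with hκ
  have hkm : AEMeasurable (fun t => ENNReal.ofReal (k t)) (volume.restrict (Ioc a b)) :=
    hk.aestronglyMeasurable.aemeasurable.ennreal_ofReal
  have hfin : IsFiniteMeasure κ := by
    refine isFiniteMeasure_withDensity ?_
    have := hk.hasFiniteIntegral
    rw [hasFiniteIntegral_iff_ofReal (Eventually.of_forall hk0)] at this
    exact this.ne
  -- The growth constant is kept only at exceptional points, so `φ` vanishes almost everywhere. Its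
  -- lower semicontinuous strict majorant `G` can therefore have `κ`-integral at most `ε`.
  let φ : ℝ → NNReal := fun t =>
    if t ∈ Ico a b → ∀ᶠ t' in 𝓝[>] t, f t' ≤ f t then 0 else A t
  have hφ0 : φ =ᵐ[κ] fun _ => 0 := by
    have h1 : ∀ᵐ t ∂(volume.restrict (Ioc a b)), φ t = 0 := by
      refine ae_restrict_of_ae ?_
      filter_upwards [hae] with t ht
      simp only [φ, if_pos ht]
    exact (withDensity_absolutelyContinuous _ _).ae_le h1
  obtain ⟨G, hφG, hGlsc, hGint⟩ := exists_lt_lowerSemicontinuous_lintegral_ge_of_aemeasurable κ φ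
    (aemeasurable_const.congr hφ0.symm) (ε := ENNReal.ofReal ε) (by simpa using εpos)
  have hzero : ∫⁻ x, (φ x : ENNReal) ∂κ = 0 := by
    rw [lintegral_congr_ae (g := fun _ => 0)]
    · simp
    · filter_upwards [hφ0] with x hx
      simp [hx]
  rw [hzero, zero_add, hκ, lintegral_withDensity_eq_lintegral_mul₀ hkm
    hGlsc.measurable.aemeasurable] at hGint
  set H0 : ℝ → ENNReal := (fun t => ENNReal.ofReal (k t)) * G with hH0
  have hH0m : AEMeasurable H0 (volume.restrict (Ioc a b)) := hkm.mul hGlsc.measurable.aemeasurable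
  have hH0fin : ∫⁻ x in Ioc a b, H0 x ≠ ⊤ := (hGint.trans_lt ENNReal.ofReal_lt_top).ne
  have hHint : IntegrableOn (fun t => (H0 t).toReal) (Ioc a b) :=
    integrable_toReal_of_lintegral_ne_top hH0m hH0fin
  have hH0ae : ∀ᵐ t ∂(volume.restrict (Ioc a b)), H0 t < ⊤ := ae_lt_top' hH0m hH0fin
  have hHI : IntegrableOn (fun t => (H0 t).toReal) (Icc a b) :=
    (integrableOn_Icc_iff_integrableOn_Ioc (by simp)).2 hHint
  set s := {t | f t - f a ≤ ∫ u in a..t, (H0 u).toReal} ∩ Icc a b with hs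
  have s_closed : IsClosed s := by
    have : ContinuousOn (fun t => (f t - f a, ∫ u in a..t, (H0 u).toReal)) (Icc a b) := by
      rw [← uIcc_of_le hab] at hf hHI ⊢
      exact (hf.sub continuousOn_const).prodMk (intervalIntegral.continuousOn_primitive_interval hHI)
    simp only [s, inter_comm]
    exact this.preimage_isClosed_of_isClosed isClosed_Icc OrderClosedTopology.isClosed_le'
  have hII : ∀ x y, a ≤ x → x ≤ y → y ≤ b →
      IntervalIntegrable (fun t => (H0 t).toReal) volume x y := fun x y h1 h2 h3 =>
    (intervalIntegrable_iff_integrableOn_Ioc_of_le h2).2 (hHint.mono_set (Ioc_subset_Ioc h1 h3))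
  have key : Icc a b ⊆ {t | f t - f a ≤ ∫ u in a..t, (H0 u).toReal} := by
    refine s_closed.Icc_subset_of_forall_exists_gt (by simp) ?_
    rintro t ⟨ht, htab⟩ v hv
    have hev : ∀ᶠ t' in 𝓝[>] t, f t' - f t ≤ ∫ u in t..t', (H0 u).toReal := by
      by_cases hgood : ∀ᶠ t' in 𝓝[>] t, f t' ≤ f t
      · filter_upwards [hgood, self_mem_nhdsWithin] with t' h1 h2
        have : 0 ≤ ∫ u in t..t', (H0 u).toReal :=
          intervalIntegral.integral_nonneg (le_of_lt h2) fun u _ => ENNReal.toReal_nonneg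
        linarith
      -- At an exceptional point, strictness and lower semicontinuity give `A t < G` on a
      -- neighbourhood, so the allowed growth `A t * ∫ k` is paid for by `∫ k G`.
      · have hφt : φ t = A t := if_neg fun h => hgood (h htab)
        have hlt : (A t : ENNReal) < G t := hφt ▸ hφG t
        have hnear : ∀ᶠ u in 𝓝 t, (A t : ENNReal) < G u := hGlsc t _ hlt
        obtain ⟨δ, δpos, hδ⟩ := Metric.eventually_nhds_iff.1 hnear
        have hI : Ioo t (min b (t + δ)) ∈ 𝓝[>] t :=
          Ioo_mem_nhdsGT (lt_min htab.2 (by linarith))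
        filter_upwards [hA t htab, hI] with t' h1 h2
        have ht'b : t' < b := h2.2.trans_le (min_le_left _ _)
        have ht'd : t' < t + δ := h2.2.trans_le (min_le_right _ _)
        refine h1.trans ?_
        rw [← intervalIntegral.integral_const_mul]
        refine intervalIntegral.integral_mono_ae_restrict h2.1.le ?_
          (hII t t' htab.1 h2.1.le ht'b.le) ?_
        · refine IntervalIntegrable.const_mul ?_ _
          exact (intervalIntegrable_iff_integrableOn_Ioc_of_le h2.1.le).2
            (hk.mono_set (Ioc_subset_Ioc htab.1 ht'b.le))
        · rw [← restrict_Ioc_eq_restrict_Icc]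
          filter_upwards [ae_restrict_of_ae_restrict_of_subset
            (Ioc_subset_Ioc htab.1 ht'b.le) hH0ae, ae_restrict_mem measurableSet_Ioc] with u hu hut
          have hGu : (A t : ENNReal) ≤ G u := by
            refine (hδ ?_).le
            rw [Real.dist_eq, abs_of_nonneg (by linarith [hut.1])]
            linarith [hut.2]
          have h3 : ENNReal.ofReal (k u) * A t ≤ H0 u := by
            rw [hH0]; exact mul_le_mul_right hGu _
          have h4 := ENNReal.toReal_mono hu.ne h3
          rw [ENNReal.toReal_mul, ENNReal.toReal_ofReal (hk0 u)] at h4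
          simpa [mul_comm] using h4
    have hI : Ioo t (min v b) ∈ 𝓝[>] t := Ioo_mem_nhdsGT (lt_min hv htab.2)
    obtain ⟨t', h1, h2⟩ := (hev.and hI).exists
    have ht'b : t' < b := h2.2.trans_le (min_le_right _ _)
    refine ⟨t', ?_, h2.1, (h2.2.trans_le (min_le_left _ _)).le⟩
    change f t' - f a ≤ _
    rw [← intervalIntegral.integral_add_adjacent_intervals (hII a t le_rfl htab.1 htab.2.le)
      (hII t t' htab.1 h2.1.le ht'b.le)]
    have : f t - f a ≤ ∫ u in a..t, (H0 u).toReal := ht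
    linarith
  have hb : f b - f a ≤ ∫ u in a..b, (H0 u).toReal := key (right_mem_Icc.2 hab)
  have : ∫ u in a..b, (H0 u).toReal ≤ ε := by
    rw [intervalIntegral.integral_of_le hab, integral_toReal hH0m hH0ae]
    exact ENNReal.toReal_le_of_le_ofReal εpos.le hGint
  linarith

/-- Version of `le_of_ae_eventually_le_of_forall_growth_Ico` with hypotheses on an open interval. -/
theorem le_of_ae_eventually_le_of_forall_growth {f k : ℝ → ℝ} {a b : ℝ} (hab : a < b)
    (hf : ContinuousOn f (Icc a b)) (hk : IntegrableOn k (Ioc a b)) (hk0 : ∀ t, 0 ≤ k t)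
    (hae : ∀ᵐ t, t ∈ Ioo a b → ∀ᶠ t' in 𝓝[>] t, f t' ≤ f t)
    (hgrow : ∀ t ∈ Ioo a b, ∃ A : ℝ, ∀ᶠ t' in 𝓝[>] t, f t' - f t ≤ A * ∫ r in t..t', k r) :
    f b ≤ f a := by
  have hcont : Tendsto f (𝓝[>] a) (𝓝 (f a)) := by
    have h1 : Tendsto f (𝓝[Ioo a b] a) (𝓝 (f a)) :=
      (hf a (left_mem_Icc.2 hab.le)).mono_left (nhdsWithin_mono _ Ioo_subset_Icc_self)
    rwa [nhdsWithin_Ioo_eq_nhdsGT hab] at h1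
  refine ge_of_tendsto hcont ?_
  filter_upwards [Ioo_mem_nhdsGT hab] with x hx
  refine le_of_ae_eventually_le_of_forall_growth_Ico hx.2.le
    (hf.mono (Icc_subset_Icc_left hx.1.le)) (hk.mono_set (Ioc_subset_Ioc_left hx.1.le)) hk0 ?_
    fun t ht => hgrow t ⟨hx.1.trans_le ht.1, ht.2⟩
  filter_upwards [hae] with t ht h
  exact ht ⟨hx.1.trans_le h.1, h.2⟩

end Monotonicity

/-! ### Gibbs measures depending on a parameter. -/

section Gibbs

variable {p w : ℕ}

theorem differentiable_param {U : Euc p → Euc w → ℝ}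
    (hU : ContDiff ℝ 1 (fun z : Euc p × Euc w => U z.1 z.2)) (x : Euc p) :
    Differentiable ℝ (U x) :=
  (hU.differentiable one_ne_zero).comp (differentiable_const x |>.prodMk differentiable_id)

theorem norm_fderiv_eq_norm_gradient {E : Type*} [NormedAddCommGroup E] [InnerProductSpace ℝ E]
    [CompleteSpace E] (f : E → ℝ) (x : E) : ‖fderiv ℝ f x‖ = ‖gradient f x‖ := by
  simp [gradient]

theorem continuous_fderiv_param {U : Euc p → Euc w → ℝ}
    (hU : ContDiff ℝ 1 (fun z : Euc p × Euc w => U z.1 z.2)) :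
    Continuous (fun z : Euc p × Euc w => fderiv ℝ (U z.1) z.2) := by
  have h : (fun z : Euc p × Euc w => fderiv ℝ (U z.1) z.2) =
      fun z => (fderiv ℝ (fun z : Euc p × Euc w => U z.1 z.2) z).comp
        (ContinuousLinearMap.inr ℝ (Euc p) (Euc w)) := by
    ext1 ⟨x, θ⟩
    have h1 := ((hU.differentiable one_ne_zero) (x, θ)).hasFDerivAt
    exact (h1.comp θ (hasFDerivAt_prodMk_right x θ)).fderiv
  rw [h]
  exact (hU.continuous_fderiv one_ne_zero).clm_comp continuous_const

theorem abs_param_sub_le {U : Euc p → Euc w → ℝ} {C : ℝ}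
    (hU : ContDiff ℝ 1 (fun z : Euc p × Euc w => U z.1 z.2))
    (hC : ∀ x θ, ‖gradient (U x) θ‖ ≤ C) (x : Euc p) (θ θ' : Euc w) :
    |U x θ' - U x θ| ≤ C * ‖θ' - θ‖ := by
  refine convex_univ.norm_image_sub_le_of_norm_fderiv_le (𝕜 := ℝ)
    (fun t _ => differentiable_param hU x t) (fun t _ => ?_) (mem_univ θ) (mem_univ θ')
  rw [norm_fderiv_eq_norm_gradient]; exact hC x t

/-- `ν θ` is the Gibbs measure of the potential `U · θ`. -/
def IsGibbsFamily (U : Euc p → Euc w → ℝ) (ν : Euc w → P2 p) : Prop :=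
  ∀ θ, ∃ Z : ℝ, 0 < Z ∧
    (ν θ).1 = volume.withDensity (fun x => ENNReal.ofReal (Real.exp (-U x θ) / Z))

theorem IsGibbsFamily.exists_withDensity {U : Euc p → Euc w → ℝ} {ν : Euc w → P2 p}
    (hU : ContDiff ℝ 1 (fun z : Euc p × Euc w => U z.1 z.2)) (hν : IsGibbsFamily U ν)
    (θ θ' : Euc w) :
    ∃ c : ℝ, 0 < c ∧ (ν θ').1 = (ν θ).1.withDensity
      (fun x => ENNReal.ofReal (c * Real.exp (-(U x θ' - U x θ)))) := by
  obtain ⟨Z, hZ, h⟩ := hν θ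
  obtain ⟨Z', hZ', h'⟩ := hν θ'
  have hm : ∀ t, Continuous fun x => U x t := fun t =>
    hU.continuous.comp (continuous_id.prodMk continuous_const)
  have h1 := hm θ
  have h2 := hm θ'
  refine ⟨Z / Z', by positivity, ?_⟩
  rw [h, h', ← withDensity_mul _ (by fun_prop) (by fun_prop)]
  congr 1
  ext x
  rw [Pi.mul_apply, ← ENNReal.ofReal_mul (by positivity)]
  congr 1
  rw [show -U x θ' = -U x θ + -(U x θ' - U x θ) by ring, Real.exp_add]
  field_simp

theorem integral_eq_smul_of_eq_withDensity {μ μ' : Measure (Euc p)} {g : Euc p → ℝ}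
    (hg : Measurable g) (hg0 : ∀ x, 0 ≤ g x) {c : ℝ} (hc : 0 < c)
    (h : μ' = μ.withDensity (fun x => ENNReal.ofReal (c * g x)))
    {Y : Type*} [NormedAddCommGroup Y] [NormedSpace ℝ Y] (a : Euc p → Y) :
    ∫ x, a x ∂μ' = c • ∫ x, g x • a x ∂μ := by
  rw [h, integral_withDensity_eq_integral_toReal_smul (by fun_prop)
    (Eventually.of_forall fun x => ENNReal.ofReal_lt_top), ← integral_smul]
  congr 1
  ext x
  rw [ENNReal.toReal_ofReal (mul_nonneg hc.le (hg0 x)), mul_smul]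

/-- Testing the density with the constant `1` identifies the ratio of partition functions, so only
integrals against the fixed measure `ν θ` remain to be differentiated. -/
theorem IsGibbsFamily.integral_eq {U : Euc p → Euc w → ℝ} {ν : Euc w → P2 p}
    (hU : ContDiff ℝ 1 (fun z : Euc p × Euc w => U z.1 z.2)) (hν : IsGibbsFamily U ν)
    (θ θ' : Euc w) {Y : Type*} [NormedAddCommGroup Y] [NormedSpace ℝ Y] (a : Euc p → Y) :
    ∫ x, a x ∂(ν θ').1 = (∫ x, Real.exp (-(U x θ' - U x θ)) ∂(ν θ).1)⁻¹ •
      ∫ x, Real.exp (-(U x θ' - U x θ)) • a x ∂(ν θ).1 := by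
  obtain ⟨c, hc, h⟩ := hν.exists_withDensity hU θ θ'
  have hm : ∀ t, Continuous fun x => U x t := fun t =>
    hU.continuous.comp (continuous_id.prodMk continuous_const)
  have h1 := hm θ
  have h2 := hm θ'
  have hone : (1 : ℝ) = c * ∫ x, Real.exp (-(U x θ' - U x θ)) ∂(ν θ).1 := by
    have := integral_eq_smul_of_eq_withDensity (by fun_prop) (fun x => (Real.exp_pos _).le) hc h (fun _ => (1 : ℝ))
    have hp := (ν θ').2.1
    simpa using this
  rw [integral_eq_smul_of_eq_withDensity (by fun_prop) (fun x => (Real.exp_pos _).le) hc h a]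
  congr 1
  exact eq_inv_of_mul_eq_one_left hone.symm

/-- The factor `2` counts `C * ‖θ' - θ‖` twice: once for the change of potential, once for the ratio
of partition functions. -/
theorem IsGibbsFamily.relClose {U : Euc p → Euc w → ℝ} {ν : Euc w → P2 p} {C : ℝ}
    (hU : ContDiff ℝ 1 (fun z : Euc p × Euc w => U z.1 z.2)) (hν : IsGibbsFamily U ν)
    (hC : ∀ x θ, ‖gradient (U x) θ‖ ≤ C) (θ θ' : Euc w) :
    RelClose (Real.exp (2 * C * ‖θ' - θ‖) - 1) (ν θ) (ν θ') := by
  obtain ⟨c, hc, h⟩ := hν.exists_withDensity hU θ θ'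
  have hp := (ν θ).2.1
  have hp' := (ν θ').2.1
  set r := C * ‖θ' - θ‖ with hr
  have hb : ∀ x, |U x θ' - U x θ| ≤ r := fun x => abs_param_sub_le hU hC x θ θ'
  have hlow : ∀ x, Real.exp (-r) ≤ Real.exp (-(U x θ' - U x θ)) := fun x =>
    Real.exp_le_exp.2 (by linarith [(abs_le.1 (hb x)).2])
  have hup : ∀ x, Real.exp (-(U x θ' - U x θ)) ≤ Real.exp r := fun x =>
    Real.exp_le_exp.2 (by linarith [(abs_le.1 (hb x)).1])
  have hle : ∀ k : ℝ, (∀ x, c * Real.exp (-(U x θ' - U x θ)) ≤ k) →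
      (ν θ').1 ≤ ENNReal.ofReal k • (ν θ).1 := by
    intro k hk
    rw [h, ← withDensity_const]
    exact withDensity_mono (Eventually.of_forall fun x => ENNReal.ofReal_le_ofReal (hk x))
  have hge : ∀ k : ℝ, (∀ x, k ≤ c * Real.exp (-(U x θ' - U x θ))) →
      ENNReal.ofReal k • (ν θ).1 ≤ (ν θ').1 := by
    intro k hk
    rw [h, ← withDensity_const]
    exact withDensity_mono (Eventually.of_forall fun x => ENNReal.ofReal_le_ofReal (hk x))
  -- Both measures have mass one, which confines `c` to `[exp (-r), exp r]`.
  have hc1 : c ≤ Real.exp r := by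
    have h1 := hge (c * Real.exp (-r)) (fun x => mul_le_mul_of_nonneg_left (hlow x) hc.le) univ
    simp only [Measure.smul_apply, measure_univ, smul_eq_mul, mul_one] at h1
    have h2 := ENNReal.ofReal_le_one.1 h1
    rw [Real.exp_neg] at h2
    have := Real.exp_pos r
    field_simp at h2
    linarith
  have hc2 : Real.exp (-r) ≤ c := by
    have h1 := hle (c * Real.exp r) (fun x => mul_le_mul_of_nonneg_left (hup x) hc.le) univ
    simp only [Measure.smul_apply, measure_univ, smul_eq_mul, mul_one] at h1
    have h2 := ENNReal.one_le_ofReal.1 h1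
    rw [Real.exp_neg]
    have := Real.exp_pos r
    rw [inv_le_iff_one_le_mul₀ this]
    exact h2
  have he : Real.exp (2 * C * ‖θ' - θ‖) = Real.exp r * Real.exp r := by
    rw [← Real.exp_add]; congr 1; rw [hr]; ring
  constructor
  · refine hge _ fun x => ?_
    calc 1 - (Real.exp (2 * C * ‖θ' - θ‖) - 1) ≤ Real.exp (-r) * Real.exp (-r) := by
          rw [he, Real.exp_neg]
          have h0 := Real.exp_pos r
          have h1 : 0 < (Real.exp r)⁻¹ := by positivity
          have h2 : Real.exp r * (Real.exp r)⁻¹ = 1 := mul_inv_cancel₀ h0.ne'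
          -- This is `2 ≤ x² + x⁻²` with `x = exp r`.
          nlinarith [sq_nonneg (Real.exp r - (Real.exp r)⁻¹)]
      _ ≤ _ := mul_le_mul hc2 (hlow x) (Real.exp_pos _).le hc.le
  · refine hle _ fun x => ?_
    calc _ ≤ Real.exp r * Real.exp r := mul_le_mul hc1 (hup x) (Real.exp_pos _).le (Real.exp_pos _).le
      _ = _ := by rw [he]; ring

theorem RelClose.integrable {n : ℕ} {s : ℝ} {ν ν' : P2 n} (h : RelClose s ν ν')
    {Y : Type*} [NormedAddCommGroup Y] {a : Euc n → Y} (ha : Integrable a ν.1) :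
    Integrable a ν'.1 :=
  (ha.smul_measure ENNReal.ofReal_ne_top).mono_measure h.2

theorem RelClose.abs_integral_sub_le_of_nonneg {n : ℕ} {s : ℝ} (hs : 0 ≤ s) {ν ν' : P2 n}
    (h : RelClose s ν ν') {a : Euc n → ℝ} (ha : Integrable a ν.1) (h0 : ∀ x, 0 ≤ a x) :
    |∫ x, a x ∂ν'.1 - ∫ x, a x ∂ν.1| ≤ s * ∫ x, a x ∂ν.1 := by
  have hI : 0 ≤ ∫ x, a x ∂ν.1 := integral_nonneg h0
  have h1 := integral_mono_measure h.2 (Eventually.of_forall h0)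
    (ha.smul_measure ENNReal.ofReal_ne_top)
  have h2 := integral_mono_measure h.1 (Eventually.of_forall h0) (h.integrable ha)
  rw [integral_smul_measure, ENNReal.toReal_ofReal (by linarith), smul_eq_mul] at h1
  rw [integral_smul_measure, smul_eq_mul] at h2
  -- For `s > 1` the lower density is truncated to `0`, which still dominates `1 - s`; no smallness
  -- of `s` is needed.
  have h3 : (1 - s) * ∫ x, a x ∂ν.1 ≤ (ENNReal.ofReal (1 - s)).toReal * ∫ x, a x ∂ν.1 :=
    mul_le_mul_of_nonneg_right (by rw [ENNReal.toReal_ofReal']; exact le_max_left _ _) hI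
  rw [abs_le]
  constructor <;> linarith

theorem RelClose.abs_integral_sub_le {n : ℕ} {s : ℝ} (hs : 0 ≤ s) {ν ν' : P2 n}
    (h : RelClose s ν ν') {a : Euc n → ℝ} (ha : Integrable a ν.1) :
    |∫ x, a x ∂ν'.1 - ∫ x, a x ∂ν.1| ≤ s * ∫ x, |a x| ∂ν.1 := by
  have e1 : ∀ x, a x = max (a x) 0 - max (-a x) 0 := fun x => by
    rcases le_total (a x) 0 with h | h
    · rw [max_eq_right h, max_eq_left (by linarith)]; ring
    · rw [max_eq_left h, max_eq_right (by linarith)]; ring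
  have e2 : ∀ x, |a x| = max (a x) 0 + max (-a x) 0 := fun x => by
    rcases le_total (a x) 0 with h | h
    · rw [max_eq_right h, max_eq_left (by linarith), abs_of_nonpos h]; ring
    · rw [max_eq_left h, max_eq_right (by linarith), abs_of_nonneg h]; ring
  have i1 : Integrable (fun x => max (a x) 0) ν.1 := ha.pos_part
  have i2 : Integrable (fun x => max (-a x) 0) ν.1 := ha.neg_part
  have b1 := h.abs_integral_sub_le_of_nonneg hs i1 (fun x => le_max_right _ _)
  have b2 := h.abs_integral_sub_le_of_nonneg hs i2 (fun x => le_max_right _ _)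
  have c1 : ∫ x, a x ∂ν'.1 = ∫ x, max (a x) 0 ∂ν'.1 - ∫ x, max (-a x) 0 ∂ν'.1 := by
    rw [← integral_sub (h.integrable i1) (h.integrable i2)]; exact integral_congr_ae (.of_forall e1)
  have c2 : ∫ x, a x ∂ν.1 = ∫ x, max (a x) 0 ∂ν.1 - ∫ x, max (-a x) 0 ∂ν.1 := by
    rw [← integral_sub i1 i2]; exact integral_congr_ae (.of_forall e1)
  have c3 : ∫ x, |a x| ∂ν.1 = ∫ x, max (a x) 0 ∂ν.1 + ∫ x, max (-a x) 0 ∂ν.1 := by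
    rw [← integral_add i1 i2]; exact integral_congr_ae (.of_forall e2)
  rw [c1, c2, c3]
  rw [abs_le] at b1 b2 ⊢
  constructor <;> linarith

theorem hasFDerivAt_integral_exp_smul {U : Euc p → Euc w → ℝ} {C : ℝ}
    (hU : ContDiff ℝ 1 (fun z : Euc p × Euc w => U z.1 z.2))
    (hC : ∀ x θ, ‖gradient (U x) θ‖ ≤ C) (μ : Measure (Euc p)) (θ : Euc w)
    {Y : Type*} [NormedAddCommGroup Y] [NormedSpace ℝ Y] {a : Euc p → Y} (ha : Integrable a μ) :
    HasFDerivAt (fun θ' => ∫ x, Real.exp (-(U x θ' - U x θ)) • a x ∂μ)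
      (∫ x, (-fderiv ℝ (U x) θ).smulRight (a x) ∂μ) θ := by
  have hC0 : 0 ≤ C := (norm_nonneg _).trans (hC 0 θ)
  have hm : ∀ t, Continuous fun x => U x t := fun t =>
    hU.continuous.comp (continuous_id.prodMk continuous_const)
  have hd : ∀ t, Continuous fun x => fderiv ℝ (U x) t := fun t =>
    (continuous_fderiv_param hU).comp (continuous_id.prodMk continuous_const)
  have h1 := hm θ
  have key := hasFDerivAt_integral_of_dominated_of_fderiv_le (𝕜 := ℝ) (μ := μ) (x₀ := θ)
    (s := Metric.ball θ 1) (bound := fun x => Real.exp C * C * ‖a x‖)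
    (F := fun θ' x => Real.exp (-(U x θ' - U x θ)) • a x)
    (F' := fun θ' x => (Real.exp (-(U x θ' - U x θ)) • -fderiv ℝ (U x) θ').smulRight (a x))
    (Metric.ball_mem_nhds θ one_pos) ?_ ?_ ?_ ?_ ?_ ?_
  · simpa using key
  · refine Eventually.of_forall fun θ' => ?_
    have h2 := hm θ'
    exact (Continuous.aestronglyMeasurable (by fun_prop)).smul ha.aestronglyMeasurable
  · simpa using ha
  · have h2 : Continuous fun x => Real.exp (-(U x θ - U x θ)) • -fderiv ℝ (U x) θ := by
      have := hd θ
      fun_prop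
    exact (ContinuousLinearMap.smulRightL ℝ (Euc w) Y).aestronglyMeasurable_comp₂
      h2.aestronglyMeasurable ha.aestronglyMeasurable
  · refine Eventually.of_forall fun x θ' hθ' => ?_
    rw [ContinuousLinearMap.norm_smulRight_apply, norm_smul, norm_neg,
      norm_fderiv_eq_norm_gradient, Real.norm_of_nonneg (Real.exp_pos _).le]
    gcongr
    · have h2 := abs_le.1 (abs_param_sub_le hU hC x θ θ')
      have h3 : ‖θ' - θ‖ ≤ 1 := by
        rw [← dist_eq_norm]; exact (Metric.mem_ball.1 hθ').le
      nlinarith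
    · exact hC x θ'
  · exact ha.norm.const_mul _
  · refine Eventually.of_forall fun x θ' _ => ?_
    have h2 : HasFDerivAt (fun θ' => -(U x θ' - U x θ)) (-fderiv ℝ (U x) θ') θ' :=
      ((differentiable_param hU x θ').hasFDerivAt.sub_const _).neg
    exact h2.exp.smul_const (a x)

/-- Quotient rule for the normalized weight: the denominator equals `1` at `θ`, so the derivative is
minus the covariance of `∂U` and `a`. -/
theorem IsGibbsFamily.hasFDerivAt_integral {U : Euc p → Euc w → ℝ} {ν : Euc w → P2 p} {C : ℝ}
    (hU : ContDiff ℝ 1 (fun z : Euc p × Euc w => U z.1 z.2)) (hν : IsGibbsFamily U ν)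
    (hC : ∀ x θ, ‖gradient (U x) θ‖ ≤ C) (θ : Euc w)
    {Y : Type*} [NormedAddCommGroup Y] [NormedSpace ℝ Y] {a : Euc p → Y}
    (ha : Integrable a (ν θ).1) :
    HasFDerivAt (fun θ' => ∫ x, a x ∂(ν θ').1)
      ((∫ x, fderiv ℝ (U x) θ ∂(ν θ).1).smulRight (∫ x, a x ∂(ν θ).1)
        - ∫ x, (fderiv ℝ (U x) θ).smulRight (a x) ∂(ν θ).1) θ := by
  have hp := (ν θ).2.1
  have hN := hasFDerivAt_integral_exp_smul hU hC (ν θ).1 θ ha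
  have hI := hasFDerivAt_integral_exp_smul hU hC (ν θ).1 θ (integrable_const (1 : ℝ))
  have e : (fun θ' => ∫ x, a x ∂(ν θ').1) = fun θ' =>
      (∫ x, Real.exp (-(U x θ' - U x θ)) • (1 : ℝ) ∂(ν θ).1)⁻¹ •
      ∫ x, Real.exp (-(U x θ' - U x θ)) • a x ∂(ν θ).1 := by
    ext θ'
    simpa using hν.integral_eq hU θ θ' a
  rw [e]
  have hone : ∫ x, Real.exp (-(U x θ - U x θ)) • (1 : ℝ) ∂(ν θ).1 = 1 := by simp
  have hinv := (hasDerivAt_inv (x := ∫ x, Real.exp (-(U x θ - U x θ)) • (1 : ℝ) ∂(ν θ).1)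
    (by rw [hone]; exact one_ne_zero)).comp_hasFDerivAt θ hI
  refine (hinv.smul hN).congr_fderiv ?_
  have e1 : ∫ x, (-fderiv ℝ (U x) θ).smulRight (a x) ∂(ν θ).1 =
      -∫ x, (fderiv ℝ (U x) θ).smulRight (a x) ∂(ν θ).1 := by
    rw [← integral_neg]
    congr 1
    ext x v
    simp
  have e2 : ∫ x, (-fderiv ℝ (U x) θ).smulRight (1 : ℝ) ∂(ν θ).1 =
      -∫ x, fderiv ℝ (U x) θ ∂(ν θ).1 := by
    rw [← integral_neg]
    congr 1
    ext x v
    simp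
  rw [e1, e2]
  ext v
  simp [sub_eq_add_neg, add_comm]

end Gibbs

/-! ### Differentiability of the outer loss. -/

section OuterLoss

variable {p d w q : ℕ}

theorem tendsto_exp_mul_norm_sub_one (C : ℝ) (θ : Euc w) :
    Tendsto (fun θ' => Real.exp (C * ‖θ' - θ‖) - 1) (𝓝 θ) (𝓝 0) := by
  have : Continuous fun θ' : Euc w => Real.exp (C * ‖θ' - θ‖) - 1 := by fun_prop
  simpa using this.tendsto θ

theorem isBigO_exp_mul_norm_sub_one (C : ℝ) (θ : Euc w) :
    (fun θ' => Real.exp (C * ‖θ' - θ‖) - 1) =O[𝓝 θ] fun θ' => θ' - θ := by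
  have h1 : HasDerivAt (fun r : ℝ => Real.exp (C * r)) (Real.exp (C * 0) * (C * 1)) 0 :=
    ((hasDerivAt_id' (0 : ℝ)).const_mul C).exp
  have h2 : Tendsto (fun θ' : Euc w => ‖θ' - θ‖) (𝓝 θ) (𝓝 0) := by
    have : Continuous fun θ' : Euc w => ‖θ' - θ‖ := by fun_prop
    simpa using this.tendsto θ
  have h3 := h1.isBigO_sub.comp_tendsto h2
  simp only [Function.comp_def, mul_zero, Real.exp_zero, sub_zero] at h3
  exact h3.of_norm_right

/-- The first-variation remainder is `o(s)` with `s = exp (2C‖θ' - θ‖) - 1 = O(‖θ' - θ‖)`, so `h`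
may be replaced by the linear functional `∫ a dν`. -/
theorem IsGibbsFamily.hasFDerivAt_comp {U : Euc p → Euc w → ℝ} {ν : Euc w → P2 p} {C : ℝ}
    (hU : ContDiff ℝ 1 (fun z : Euc p × Euc w => U z.1 z.2)) (hν : IsGibbsFamily U ν)
    (hC : ∀ x θ, ‖gradient (U x) θ‖ ≤ C) (θ : Euc w)
    {Y : Type*} [NormedAddCommGroup Y] [NormedSpace ℝ Y] {h : P2 p → Y} {a : Euc p → Y}
    (ha : HasFirstVariation h (ν θ) a) :
    HasFDerivAt (fun θ' => h (ν θ'))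
      ((∫ x, fderiv ℝ (U x) θ ∂(ν θ).1).smulRight (∫ x, a x ∂(ν θ).1)
        - ∫ x, (fderiv ℝ (U x) θ).smulRight (a x) ∂(ν θ).1) θ := by
  have hC0 : 0 ≤ C := (norm_nonneg _).trans (hC 0 θ)
  have h1 := hν.hasFDerivAt_integral hU hC θ ha.1
  have hrem : (fun θ' => h (ν θ') - h (ν θ) - (∫ x, a x ∂(ν θ').1 - ∫ x, a x ∂(ν θ).1))
      =o[𝓝 θ] fun θ' => θ' - θ := by
    refine Asymptotics.IsLittleO.trans_isBigO ?_ (isBigO_exp_mul_norm_sub_one (2 * C) θ)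
    rw [Asymptotics.isLittleO_iff]
    intro c hc
    obtain ⟨δ, hδ, hδ'⟩ := ha.2 c hc
    filter_upwards [(tendsto_exp_mul_norm_sub_one (2 * C) θ).eventually_lt_const hδ] with θ' h2
    have h3 : 0 ≤ Real.exp (2 * C * ‖θ' - θ‖) - 1 := by
      have := Real.one_le_exp (x := 2 * C * ‖θ' - θ‖) (by positivity)
      linarith
    rw [Real.norm_of_nonneg h3]
    exact hδ' _ _ h3 h2 (hν.relClose hU hC θ θ')
  rw [hasFDerivAt_iff_isLittleO] at h1 ⊢
  refine (hrem.add h1).congr_left fun θ' => ?_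
  abel

theorem IsGibbsFamily.hasGradientAt_loss {U : Euc p → Euc w → ℝ} {ν : Euc w → P2 p} {C : ℝ}
    (hU : ContDiff ℝ 1 (fun z : Euc p × Euc w => U z.1 z.2)) (hν : IsGibbsFamily U ν)
    (hC : ∀ x θ, ‖gradient (U x) θ‖ ≤ C) (θ : Euc w) {h : P2 p → Euc q} {a : Euc p → Euc q}
    (ha : HasFirstVariation h (ν θ) a) {f : Euc q → ℝ} (hf : Differentiable ℝ f) :
    HasGradientAt (fun θ' => f (h (ν θ')))
      (-contractedCov (ν θ) a (fun x => gradient (U x) θ) (gradient f (h (ν θ)))) θ := by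
  have hp := (ν θ).2.1
  have h1 := hν.hasFDerivAt_comp hU hC θ ha
  have h2 := (hf (h (ν θ))).hasFDerivAt.comp θ h1
  rw [hasGradientAt_iff_hasFDerivAt]
  refine h2.congr_fderiv ?_
  set g := gradient f (h (ν θ)) with hg
  have hfd : fderiv ℝ f (h (ν θ)) = InnerProductSpace.toDual ℝ _ g := by simp [hg, gradient]
  have hd : Continuous fun x => fderiv ℝ (U x) θ :=
    (continuous_fderiv_param hU).comp (continuous_id.prodMk continuous_const)
  have hdg : Continuous fun x => gradient (U x) θ :=
    (InnerProductSpace.toDual ℝ (Euc w)).symm.continuous.comp hd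
  have hdint : Integrable (fun x => fderiv ℝ (U x) θ) (ν θ).1 :=
    Integrable.of_bound hd.aestronglyMeasurable C
      (.of_forall fun x => by rw [norm_fderiv_eq_norm_gradient]; exact hC x θ)
  have hdgint : Integrable (fun x => gradient (U x) θ) (ν θ).1 :=
    Integrable.of_bound hdg.aestronglyMeasurable C (.of_forall fun x => hC x θ)
  have hga : Integrable (fun x => (inner ℝ g (a x) : ℝ)) (ν θ).1 := ha.1.const_inner g
  have hgaU : Integrable (fun x => (inner ℝ g (a x) : ℝ) • gradient (U x) θ) (ν θ).1 :=
    hga.smul_bdd C hdg.aestronglyMeasurable (.of_forall fun x => hC x θ)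
  have hsm : Integrable (fun x => (fderiv ℝ (U x) θ).smulRight (a x)) (ν θ).1 := by
    refine (ha.1.norm.const_mul C).mono' ((ContinuousLinearMap.smulRightL ℝ (Euc w)
      (Euc q)).aestronglyMeasurable_comp₂ hd.aestronglyMeasurable ha.1.aestronglyMeasurable)
      (.of_forall fun x => ?_)
    rw [ContinuousLinearMap.norm_smulRight_apply, norm_fderiv_eq_norm_gradient]
    gcongr
    exact hC x θ
  ext v
  have e0 : ∀ x, fderiv ℝ (U x) θ v = inner ℝ (gradient (U x) θ) v := fun x => by
    simp [gradient]
  have hsv : Integrable (fun x => (inner ℝ (gradient (U x) θ) v : ℝ) • a x) (ν θ).1 := by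
    have := (ContinuousLinearMap.apply ℝ (Euc q) v).integrable_comp hsm
    refine this.congr (.of_forall fun x => ?_)
    change fderiv ℝ (U x) θ v • a x = _
    rw [e0]
  rw [ContinuousLinearMap.comp_apply, hfd, InnerProductSpace.toDual_apply_apply,
    InnerProductSpace.toDual_apply_apply, sub_apply,
    ContinuousLinearMap.smulRight_apply, ContinuousLinearMap.integral_apply hdint,
    ContinuousLinearMap.integral_apply hsm]
  simp only [ContinuousLinearMap.smulRight_apply, e0]
  rw [contractedCov, inner_neg_left, inner_sub_left, inner_sub_right, inner_smul_left,
    inner_smul_right, ← integral_inner hsv, real_inner_comm v, real_inner_comm v,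
    ← integral_inner hgaU, ← integral_inner hdgint]
  simp only [inner_smul_right, conj_trivial, real_inner_comm v, ← mul_comm (inner ℝ g (a _))]
  ring_nf

theorem hasGradientAt_integral_of_bounded {Ω : Type*} [MeasurableSpace Ω] {P : Measure Ω}
    [IsFiniteMeasure P] {f : Ω → Euc w → ℝ} {g : Ω → Euc w → Euc w} {C : ℝ}
    (hf : ∀ θ, Integrable (fun z => f z θ) P) (hg : ∀ z θ, HasGradientAt (f z) (g z θ) θ)
    (hC : ∀ᵐ z ∂P, ∀ θ, ‖g z θ‖ ≤ C) (θ : Euc w) :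
    Integrable (fun z => g z θ) P ∧
      HasGradientAt (fun θ => ∫ z, f z θ ∂P) (∫ z, g z θ ∂P) θ := by
  have hm : AEStronglyMeasurable (fun z => g z θ) P := by
    have hcoord : ∀ i : Fin w, AEMeasurable (fun z => g z θ i) P := by
      intro i
      -- Each coordinate of the gradient is a limit of difference quotients with step `1 / (n + 1)`;
      -- measurability in `z` comes from that of the loss.
      refine aemeasurable_of_tendsto_metrizable_ae (u := atTop)
        (f := fun (n : ℕ) z => ((n : ℝ) + 1) *
          (f z (θ + ((n : ℝ) + 1)⁻¹ • EuclideanSpace.single i 1) - f z θ)) (fun n =>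
        ((hf _).aemeasurable.sub (hf _).aemeasurable).const_mul _) (.of_forall fun z => ?_)
      have h1 := (hg z θ).hasFDerivAt
      have h2 := h1.lim (c := fun n : ℕ => (n : ℝ) + 1) (l := atTop)
        (EuclideanSpace.single i (1 : ℝ)) ?_
      · simpa [EuclideanSpace.inner_single_right] using h2
      · refine tendsto_norm_atTop_atTop.comp ?_
        exact tendsto_atTop_add_const_right _ _ tendsto_natCast_atTop_atTop
    have h2 : AEMeasurable (fun z => WithLp.ofLp (g z θ)) P := aemeasurable_pi_lambda _ hcoord
    exact ((WithLp.measurable_toLp 2 (Fin w → ℝ)).comp_aemeasurable h2).aestronglyMeasurable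
  have hint : Integrable (fun z => g z θ) P :=
    Integrable.of_bound hm C (hC.mono fun z hz => hz θ)
  refine ⟨hint, ?_⟩
  rw [hasGradientAt_iff_hasFDerivAt]
  have key := hasFDerivAt_integral_of_dominated_of_fderiv_le (𝕜 := ℝ) (μ := P) (x₀ := θ)
    (s := univ) (bound := fun _ => C) (F := fun θ z => f z θ)
    (F' := fun θ z => InnerProductSpace.toDual ℝ (Euc w) (g z θ)) univ_mem
    (.of_forall fun θ => (hf θ).aestronglyMeasurable) (hf θ)
    ((InnerProductSpace.toDual ℝ (Euc w)).continuous.comp_aestronglyMeasurable hm)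
    (hC.mono fun z hz θ _ => by simpa using hz θ) (integrable_const C)
    (.of_forall fun z θ _ => (hg z θ).hasFDerivAt)
  refine key.congr_fderiv ?_
  exact (InnerProductSpace.toDual ℝ (Euc w)).toContinuousLinearEquiv.toContinuousLinearMap
    |>.integral_comp_comm hint

end OuterLoss

/-! ### Couplings and the Wasserstein distance. -/

section Couplings

variable {n : ℕ}

theorem abs_integral_inner_le_sqrt_mul_sqrt {Ω E : Type*} [MeasurableSpace Ω] {μ : Measure Ω}
    [NormedAddCommGroup E] [InnerProductSpace ℝ E] {f g : Ω → E}
    (hf : MemLp f 2 μ) (hg : MemLp g 2 μ) :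
    |∫ x, inner ℝ (f x) (g x) ∂μ| ≤ √(∫ x, ‖f x‖ ^ 2 ∂μ) * √(∫ x, ‖g x‖ ^ 2 ∂μ) := by
  have h1 := integral_mul_norm_le_Lp_mul_Lq (μ := μ) (f := f) (g := g) Real.HolderConjugate.two_two
    (by simpa using hf) (by simpa using hg)
  simp only [Real.rpow_two, ← Real.sqrt_eq_rpow] at h1
  refine le_trans ?_ h1
  refine (abs_integral_le_integral_abs).trans ?_
  have hi : Integrable (fun x => ‖f x‖ * ‖g x‖) μ := hf.norm.integrable_mul hg.norm
  refine integral_mono_of_nonneg (.of_forall fun x => abs_nonneg _) hi (.of_forall fun x => ?_)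
  exact abs_real_inner_le_norm _ _

theorem P2.memLp_id (μ : P2 n) : MemLp (fun x : Euc n => x) 2 μ.1 :=
  (memLp_two_iff_integrable_sq_norm aestronglyMeasurable_id).2 μ.2.2

theorem IsCoupling.isProbabilityMeasure {γ : Measure (Euc n × Euc n)} {μ ν : P2 n}
    (h : IsCoupling γ μ ν) : IsProbabilityMeasure γ := by
  have hp := μ.2.1
  constructor
  rw [← hp.measure_univ, ← h.1, Measure.map_apply measurable_fst MeasurableSet.univ, preimage_univ]

theorem IsCoupling.measurePreserving_fst {γ : Measure (Euc n × Euc n)} {μ ν : P2 n}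
    (h : IsCoupling γ μ ν) : MeasurePreserving Prod.fst γ μ.1 := ⟨measurable_fst, h.1⟩

theorem IsCoupling.measurePreserving_snd {γ : Measure (Euc n × Euc n)} {μ ν : P2 n}
    (h : IsCoupling γ μ ν) : MeasurePreserving Prod.snd γ ν.1 := ⟨measurable_snd, h.2⟩

theorem IsCoupling.memLp_sub {γ : Measure (Euc n × Euc n)} {μ ν : P2 n}
    (h : IsCoupling γ μ ν) : MemLp (fun z : Euc n × Euc n => z.2 - z.1) 2 γ :=
  (ν.memLp_id.comp_measurePreserving h.measurePreserving_snd).sub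
    (μ.memLp_id.comp_measurePreserving h.measurePreserving_fst)

theorem integral_comp_fst {γ : Measure (Euc n × Euc n)} {μ ν : P2 n} (h : IsCoupling γ μ ν)
    {f : Euc n → ℝ} (hf : AEStronglyMeasurable f μ.1) : ∫ z, f z.1 ∂γ = ∫ x, f x ∂μ.1 := by
  rw [← h.1] at hf ⊢
  exact (integral_map measurable_fst.aemeasurable hf).symm

theorem integral_comp_snd {γ : Measure (Euc n × Euc n)} {μ ν : P2 n} (h : IsCoupling γ μ ν)
    {f : Euc n → ℝ} (hf : AEStronglyMeasurable f ν.1) : ∫ z, f z.2 ∂γ = ∫ x, f x ∂ν.1 := by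
  rw [← h.2] at hf ⊢
  exact (integral_map measurable_snd.aemeasurable hf).symm

theorem transportCost_eq (γ : Measure (Euc n × Euc n)) :
    transportCost γ = √(∫ z, ‖z.2 - z.1‖ ^ 2 ∂γ) := by
  simp only [transportCost, norm_sub_rev]

theorem sq_transportCost (γ : Measure (Euc n × Euc n)) :
    transportCost γ ^ 2 = ∫ z, ‖z.2 - z.1‖ ^ 2 ∂γ := by
  rw [transportCost_eq, Real.sq_sqrt (integral_nonneg fun z => by positivity)]

theorem transportCost_nonneg (γ : Measure (Euc n × Euc n)) : 0 ≤ transportCost γ :=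
  Real.sqrt_nonneg _

theorem IsCoupling.abs_integral_inner_le {γ : Measure (Euc n × Euc n)} {μ ν : P2 n}
    (h : IsCoupling γ μ ν) {ξ : Euc n → Euc n} (hξ : MemLp ξ 2 μ.1) :
    |∫ z, inner ℝ (ξ z.1) (z.2 - z.1) ∂γ| ≤ √(∫ x, ‖ξ x‖ ^ 2 ∂μ.1) * transportCost γ := by
  rw [transportCost_eq, ← integral_comp_fst h (f := fun x => ‖ξ x‖ ^ 2)
    (hξ.aestronglyMeasurable.norm.pow 2)]
  exact abs_integral_inner_le_sqrt_mul_sqrt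
    (hξ.comp_measurePreserving h.measurePreserving_fst) h.memLp_sub

/-- Near-optimal couplings suffice along the flow, because the expansion in `HasDivDerivAt` holds
for all couplings; attainment of the infimum is never required. -/
theorem exists_isCoupling_transportCost_lt (μ ν : P2 n) {ε : ℝ} (hε : 0 < ε) :
    ∃ γ, IsCoupling γ μ ν ∧ transportCost γ < W2 μ ν + ε := by
  have h1 := μ.2.1
  have h2 := ν.2.1
  have hne : {c : ℝ | ∃ γ : Measure (Euc n × Euc n), IsCoupling γ μ ν ∧
      c = transportCost γ}.Nonempty :=
    ⟨_, μ.1.prod ν.1, ⟨by simp, by simp⟩, rfl⟩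
  obtain ⟨c, ⟨γ, hγ, rfl⟩, hc⟩ := Real.lt_sInf_add_pos hne hε
  exact ⟨γ, hγ, hc⟩

theorem W2_nonneg (μ ν : P2 n) : 0 ≤ W2 μ ν :=
  Real.sInf_nonneg fun _ ⟨γ, _, hc⟩ => hc ▸ transportCost_nonneg γ

theorem IsCoupling.swap {γ : Measure (Euc n × Euc n)} {μ ν : P2 n} (h : IsCoupling γ μ ν) :
    IsCoupling (γ.map Prod.swap) ν μ := by
  constructor
  · rw [Measure.map_map measurable_fst measurable_swap]; exact h.2
  · rw [Measure.map_map measurable_snd measurable_swap]; exact h.1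

theorem transportCost_swap (γ : Measure (Euc n × Euc n)) :
    transportCost (γ.map Prod.swap) = transportCost γ := by
  rw [transportCost_eq, transportCost, integral_map measurable_swap.aemeasurable
    (Continuous.aestronglyMeasurable (by fun_prop))]
  rfl

theorem W2_comm (μ ν : P2 n) : W2 μ ν = W2 ν μ := by
  unfold W2
  congr 1
  ext c
  constructor <;>
  · rintro ⟨γ, h, rfl⟩
    exact ⟨_, h.swap, (transportCost_swap γ).symm⟩

end Couplings

/-! ### Test functions and their Taylor expansion along couplings. -/

section TestFunctions

variable {n : ℕ}

theorem continuous_gradient_of_contDiff {ψ : Euc n → ℝ} (h : ContDiff ℝ (⊤ : ℕ∞) ψ) :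
    Continuous (gradient ψ) :=
  (InnerProductSpace.toDual ℝ (Euc n)).symm.continuous.comp (h.continuous_fderiv (by simp))

theorem gradient_eq_zero_of_notMem_tsupport {ψ : Euc n → ℝ} {x : Euc n} (hx : x ∉ tsupport ψ) :
    gradient ψ x = 0 := by
  have : fderiv ℝ ψ x = 0 := by
    by_contra h
    exact hx (support_fderiv_subset ℝ (f := ψ) h)
  simp [gradient, this]

/-- A countable set of smooth compactly supported functions whose gradients are uniformly dense
among the gradients of smooth compactly supported functions. -/
theorem exists_countable_dense_gradients (n : ℕ) : ∃ T : Set (Euc n → ℝ), T.Countable ∧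
    (∀ ψ ∈ T, ContDiff ℝ (⊤ : ℕ∞) ψ ∧ HasCompactSupport ψ) ∧
    ∀ φ : Euc n → ℝ, ContDiff ℝ (⊤ : ℕ∞) φ → HasCompactSupport φ → ∀ η : ℝ, 0 < η →
      ∃ ψ ∈ T, ∀ x, ‖gradient φ x - gradient ψ x‖ ≤ η := by
  -- Subspaces of the second countable space `C(Euc n, Euc n)` are separable. Confining supports to
  -- one ball turns convergence on compact sets into uniform convergence.
  let S : ℕ → Set C(Euc n, Euc n) := fun R => {g | ∃ ψ : Euc n → ℝ, ContDiff ℝ (⊤ : ℕ∞) ψ ∧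
    tsupport ψ ⊆ Metric.closedBall 0 R ∧ ⇑g = gradient ψ}
  have hex : ∀ R, ∃ A : Set (S R), A.Countable ∧ Dense A := fun R =>
    TopologicalSpace.exists_countable_dense (S R)
  choose A hAc hAd using hex
  choose Ψ hΨ1 hΨ2 hΨ3 using fun (R : ℕ) (g : S R) => g.2
  refine ⟨⋃ R, Ψ R '' A R, countable_iUnion fun R => (hAc R).image _, ?_, ?_⟩
  · intro ψ hψ
    obtain ⟨R, g, -, rfl⟩ := mem_iUnion.1 hψ
    exact ⟨hΨ1 R g, HasCompactSupport.of_support_subset_isCompact (isCompact_closedBall 0 (R : ℝ))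
      (subset_closure.trans (hΨ2 R g))⟩
  · intro φ hφ hφc η hη
    obtain ⟨r, hr⟩ := hφc.isCompact.isBounded.subset_closedBall 0
    obtain ⟨R, hR⟩ := exists_nat_ge r
    have hsub : tsupport φ ⊆ Metric.closedBall 0 (R : ℝ) :=
      hr.trans (Metric.closedBall_subset_closedBall hR)
    let g : S R := ⟨⟨gradient φ, continuous_gradient_of_contDiff hφ⟩, φ, hφ, hsub, rfl⟩
    have h1 : TendstoUniformlyOn (fun (f : C(Euc n, Euc n)) x => f x) g.1 (𝓝 g.1)
        (Metric.closedBall 0 (R : ℝ)) :=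
      ContinuousMap.tendsto_iff_forall_isCompact_tendstoUniformlyOn.1 tendsto_id _
        (isCompact_closedBall 0 (R : ℝ))
    have h2 := Metric.tendstoUniformlyOn_iff.1 h1 η hη
    have h3 : ∀ᶠ f : S R in 𝓝 g, ∀ x ∈ Metric.closedBall (0 : Euc n) (R : ℝ),
        dist (g.1 x) (f.1 x) < η := continuous_subtype_val.continuousAt.eventually h2
    obtain ⟨f, hf1, hf2⟩ := (hAd R).inter_nhds_nonempty h3
    refine ⟨Ψ R f, mem_iUnion.2 ⟨R, f, hf1, rfl⟩, fun x => ?_⟩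
    by_cases hx : x ∈ Metric.closedBall (0 : Euc n) (R : ℝ)
    · have h4 := hf2 x hx
      rw [hΨ3 R f, dist_eq_norm] at h4
      exact h4.le
    · rw [gradient_eq_zero_of_notMem_tsupport fun h => hx (hsub h),
        gradient_eq_zero_of_notMem_tsupport fun h => hx (hΨ2 R f h)]
      simpa using hη.le

theorem exists_abs_sub_sub_inner_gradient_le {ψ : Euc n → ℝ} (h : ContDiff ℝ (⊤ : ℕ∞) ψ)
    (hc : HasCompactSupport ψ) : ∃ L : ℝ, 0 ≤ L ∧ ∀ x y,
      |ψ y - ψ x - inner ℝ (gradient ψ x) (y - x)| ≤ L * ‖y - x‖ ^ 2 := by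
  obtain ⟨L, hL⟩ := ContDiff.lipschitzWith_of_hasCompactSupport (hc.fderiv (𝕜 := ℝ))
    (h.fderiv_right (m := 1) (WithTop.coe_le_coe.2 le_top)) one_ne_zero
  refine ⟨L, L.2, fun x y => ?_⟩
  have h1 := (convex_closedBall x ‖y - x‖).norm_image_sub_le_of_norm_fderiv_le' (𝕜 := ℝ) (f := ψ)
    (φ := fderiv ℝ ψ x) (C := L * ‖y - x‖) (fun z _ => (h.differentiable (by simp)) z)
    (fun z hz => ?_) (Metric.mem_closedBall_self (norm_nonneg _))
    (show y ∈ Metric.closedBall x ‖y - x‖ by simp [dist_eq_norm])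
  · rw [Real.norm_eq_abs] at h1
    simp only [gradient, InnerProductSpace.toDual_symm_apply]
    linarith [h1]
  · rw [← dist_eq_norm]
    refine (hL.dist_le_mul z x).trans ?_
    gcongr
    exact Metric.mem_closedBall.1 hz

/-- Integrating the quadratic Taylor bound trades the displacement paired with `∇ψ` for a difference
of means of `ψ`, the quantity governed by the continuity equation. -/
theorem IsCoupling.integral_inner_gradient_le {γ : Measure (Euc n × Euc n)} {μ ν : P2 n}
    (hγ : IsCoupling γ μ ν) {ψ : Euc n → ℝ} (h : ContDiff ℝ (⊤ : ℕ∞) ψ)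
    (hc : HasCompactSupport ψ) {L : ℝ}
    (hL : ∀ x y, |ψ y - ψ x - inner ℝ (gradient ψ x) (y - x)| ≤ L * ‖y - x‖ ^ 2) :
    ∫ z, inner ℝ (gradient ψ z.1) (z.2 - z.1) ∂γ ≤
      ∫ x, ψ x ∂ν.1 - ∫ x, ψ x ∂μ.1 + L * transportCost γ ^ 2 := by
  have hp := hγ.isProbabilityMeasure
  have hpμ := μ.2.1
  obtain ⟨B, hB⟩ := hc.exists_bound_of_continuous h.continuous
  have hcont := h.continuous
  have i1 : Integrable (fun z : Euc n × Euc n => ψ z.1) γ :=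
    Integrable.of_bound (Continuous.aestronglyMeasurable (by fun_prop)) B (.of_forall fun z => hB _)
  have i2 : Integrable (fun z : Euc n × Euc n => ψ z.2) γ :=
    Integrable.of_bound (Continuous.aestronglyMeasurable (by fun_prop)) B (.of_forall fun z => hB _)
  have i3 : Integrable (fun z : Euc n × Euc n => L * ‖z.2 - z.1‖ ^ 2) γ :=
    hγ.memLp_sub.integrable_norm_pow (by norm_num) |>.const_mul L
  have i12 : Integrable (fun z : Euc n × Euc n => ψ z.2 - ψ z.1) γ := i2.sub i1
  rw [sq_transportCost, ← integral_comp_fst hγ hcont.aestronglyMeasurable,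
    ← integral_comp_snd hγ hcont.aestronglyMeasurable, ← integral_const_mul,
    ← integral_sub i2 i1, ← integral_add i12 i3]
  have i4 : Integrable (fun z : Euc n × Euc n => (inner ℝ (gradient ψ z.1) (z.2 - z.1) : ℝ)) γ := by
    have hg := continuous_gradient_of_contDiff h
    refine ((i12.norm.add i3)).mono' (Continuous.aestronglyMeasurable (by fun_prop))
      (.of_forall fun z => ?_)
    have := hL z.1 z.2
    rw [abs_le] at this
    simp only [Pi.add_apply, Real.norm_eq_abs]
    have h1 := abs_le.1 (le_refl |ψ z.2 - ψ z.1|)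
    rw [abs_le]
    constructor <;> linarith
  refine integral_mono i4 (i12.add i3) fun z => ?_
  have := (abs_le.1 (hL z.1 z.2)).1
  linarith

end TestFunctions

/-! ### Chain rule along solutions of the continuity equation. -/

section ChainRule

variable {n : ℕ}

theorem sqrt_integral_sq_norm_eq {Ω E : Type*} [MeasurableSpace Ω] {μ : Measure Ω}
    [NormedAddCommGroup E] {f : Ω → E} (hf : MemLp f 2 μ) :
    √(∫ x, ‖f x‖ ^ 2 ∂μ) = (eLpNorm f 2 μ).toReal := by
  rw [hf.eLpNorm_eq_integral_rpow_norm (by norm_num) (by norm_num),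
    ENNReal.toReal_ofReal (by positivity), Real.sqrt_eq_rpow]
  simp

theorem integrable_inner_of_memLp_two {Ω E : Type*} [MeasurableSpace Ω] {μ : Measure Ω}
    [NormedAddCommGroup E] [InnerProductSpace ℝ E] {f g : Ω → E}
    (hf : MemLp f 2 μ) (hg : MemLp g 2 μ) : Integrable (fun x => (inner ℝ (f x) (g x) : ℝ)) μ :=
  (hf.norm.integrable_mul hg.norm).mono' (hf.1.inner hg.1)
    (.of_forall fun _ => norm_inner_le_norm _ _)

theorem ae_hasDerivAt_integral_of_forall_intervalIntegrable {f : ℝ → ℝ}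
    (hf : ∀ T, 0 ≤ T → IntervalIntegrable f volume 0 T) :
    ∀ᵐ t, 0 < t → HasDerivAt (fun x => ∫ r in (0 : ℝ)..x, f r) (f t) t := by
  have h : ∀ᵐ t, ∀ k : ℕ, t ∈ uIcc (0 : ℝ) k → ∀ c ∈ uIcc (0 : ℝ) k,
      HasDerivAt (fun x => ∫ r in c..x, f r) (f t) t :=
    ae_all_iff.2 fun k => (hf k k.cast_nonneg).ae_hasDerivAt_integral
  filter_upwards [h] with t ht h0
  obtain ⟨k, hk⟩ := exists_nat_ge t
  have hk0 : (0 : ℝ) ≤ k := k.cast_nonneg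
  exact ht k (by rw [uIcc_of_le hk0]; exact ⟨h0.le, hk⟩) 0 (by simp)

theorem HasDerivAt.eventually_sub_le {F : ℝ → ℝ} {F' c t : ℝ} (h : HasDerivAt F F' t)
    (hc : F' < c) : ∀ᶠ t' in 𝓝[>] t, F t' - F t ≤ c * (t' - t) := by
  have h1 := (h.hasDerivWithinAt (s := Ioi t)).limsup_slope_le hc
  rw [sdiff_singleton_eq_self self_notMem_Ioi] at h1
  filter_upwards [h1, self_mem_nhdsWithin] with t' h2 h3
  have h4 : 0 < t' - t := sub_pos.2 h3
  rw [slope_def_field, div_lt_iff₀ h4] at h2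
  exact h2.le

/-- The continuity equation sees only gradients of test functions, and tangency says that `ξ` is an
`L²` limit of these. Couplings of cost `O(t' - t)` make the approximation error linear and the
Taylor remainder quadratic in `t' - t`. -/
theorem eventually_integral_inner_le {T : Set (Euc n → ℝ)}
    (hT : ∀ ψ ∈ T, ContDiff ℝ (⊤ : ℕ∞) ψ ∧ HasCompactSupport ψ)
    (hTd : ∀ φ : Euc n → ℝ, ContDiff ℝ (⊤ : ℕ∞) φ → HasCompactSupport φ → ∀ η : ℝ, 0 < η →
      ∃ ψ ∈ T, ∀ x, ‖gradient φ x - gradient ψ x‖ ≤ η)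
    {μ : ℝ → P2 n} {t : ℝ} {v : Euc n → Euc n} (hv : MemLp v 2 (μ t).1)
    (hder : ∀ ψ ∈ T, ∀ c, ∫ x, inner ℝ (gradient ψ x) (v x) ∂(μ t).1 < c →
      ∀ᶠ t' in 𝓝[>] t, ∫ x, ψ x ∂(μ t').1 - ∫ x, ψ x ∂(μ t).1 ≤ c * (t' - t))
    {ξ : Euc n → Euc n} (hξ : IsTangent (μ t) ξ) {K η : ℝ} (hK : 0 ≤ K) (hη : 0 < η) :
    ∀ᶠ t' in 𝓝[>] t, ∀ γ, IsCoupling γ (μ t) (μ t') → transportCost γ ≤ K * (t' - t) →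
      ∫ z, inner ℝ (ξ z.1) (z.2 - z.1) ∂γ ≤
        (∫ x, inner ℝ (ξ x) (v x) ∂(μ t).1 + η) * (t' - t) := by
  have hp := (μ t).2.1
  set Nv := √(∫ x, ‖v x‖ ^ 2 ∂(μ t).1) with hNv
  have hNv0 : 0 ≤ Nv := Real.sqrt_nonneg _
  -- Replacing `ξ` by `gradient ψ` costs `2e` in `L²`: `e` to reach some test gradient and `e` to
  -- reach the countable family. Paired with displacement and velocity this uses `η / 2`; the slope
  -- and the Taylor remainder use `η / 4` each.
  set e := η / (4 * (K + Nv + 1)) with he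
  have he0 : 0 < e := by positivity
  have heK : 2 * e * (K + Nv) ≤ η / 2 := by
    have : e * (4 * (K + Nv + 1)) = η := by rw [he]; field_simp
    nlinarith
  obtain ⟨φ, hφ, hφc, hφe⟩ := hξ.2 e he0
  obtain ⟨ψ, hψT, hψ⟩ := hTd φ hφ hφc e he0
  obtain ⟨hψs, hψc⟩ := hT ψ hψT
  obtain ⟨L, hL0, hL⟩ := exists_abs_sub_sub_inner_gradient_le hψs hψc
  have hgc := continuous_gradient_of_contDiff hψs
  have hgψ : MemLp (gradient ψ) 2 (μ t).1 := by
    obtain ⟨B, hB⟩ := hψc.fderiv (𝕜 := ℝ) |>.exists_bound_of_continuous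
      (hψs.continuous_fderiv (by simp))
    exact MemLp.of_bound hgc.aestronglyMeasurable B
      (.of_forall fun x => by rw [← norm_fderiv_eq_norm_gradient]; exact hB x)
  have hζ : MemLp (fun x => ξ x - gradient ψ x) 2 (μ t).1 := hξ.1.sub hgψ
  have hζe : √(∫ x, ‖ξ x - gradient ψ x‖ ^ 2 ∂(μ t).1) ≤ 2 * e := by
    rw [sqrt_integral_sq_norm_eq hζ]
    refine ENNReal.toReal_le_of_le_ofReal (by positivity) ?_
    have hgφc := continuous_gradient_of_contDiff hφ
    have h1 : eLpNorm (fun x => gradient φ x - gradient ψ x) 2 (μ t).1 ≤ ENNReal.ofReal e := by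
      refine (eLpNorm_le_of_ae_bound (.of_forall hψ)).trans ?_
      simp
    have h2 : (fun x => ξ x - gradient ψ x) =
        (fun x => ξ x - gradient φ x) + fun x => gradient φ x - gradient ψ x := by
      ext1 x; simp
    rw [h2, two_mul, ENNReal.ofReal_add he0.le he0.le]
    refine (eLpNorm_add_le (hξ.1.aestronglyMeasurable.sub hgφc.aestronglyMeasurable)
      (hgφc.sub hgc).aestronglyMeasurable (by norm_num)).trans (add_le_add hφe h1)
  have hψv : ∫ x, inner ℝ (gradient ψ x) (v x) ∂(μ t).1 ≤
      ∫ x, inner ℝ (ξ x) (v x) ∂(μ t).1 + 2 * e * Nv := by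
    have h1 := abs_integral_inner_le_sqrt_mul_sqrt hζ hv
    have h2 : ∫ x, inner ℝ (ξ x - gradient ψ x) (v x) ∂(μ t).1 =
        ∫ x, inner ℝ (ξ x) (v x) ∂(μ t).1 - ∫ x, inner ℝ (gradient ψ x) (v x) ∂(μ t).1 := by
      simp only [inner_sub_left]
      exact integral_sub (integrable_inner_of_memLp_two hξ.1 hv) (integrable_inner_of_memLp_two hgψ hv)
    rw [h2] at h1
    have h3 := (abs_le.1 (h1.trans (mul_le_mul_of_nonneg_right hζe hNv0))).1
    linarith
  have hsmall : ∀ᶠ t' in 𝓝[>] t, L * K ^ 2 * (t' - t) ≤ η / 4 := by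
    have : Tendsto (fun t' => L * K ^ 2 * (t' - t)) (𝓝[>] t) (𝓝 0) := by
      have hc : Continuous fun t' => L * K ^ 2 * (t' - t) := by fun_prop
      have := hc.tendsto t
      rw [sub_self, mul_zero] at this
      exact this.mono_left nhdsWithin_le_nhds
    exact (this.eventually_lt_const (by positivity)).mono fun _ h => h.le
  filter_upwards [hder ψ hψT (∫ x, inner ℝ (gradient ψ x) (v x) ∂(μ t).1 + η / 4) (by linarith),
    hsmall, self_mem_nhdsWithin] with t' h1 h2 h3 γ hγ hγK
  have h0 : 0 < t' - t := sub_pos.2 h3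
  have hc0 := transportCost_nonneg γ
  have b1 := hγ.integral_inner_gradient_le hψs hψc hL
  have b2 := (abs_le.1 ((hγ.abs_integral_inner_le hζ).trans
    (mul_le_mul hζe hγK hc0 (by positivity)))).2
  have b3 : ∫ z, inner ℝ (ξ z.1 - gradient ψ z.1) (z.2 - z.1) ∂γ =
      ∫ z, inner ℝ (ξ z.1) (z.2 - z.1) ∂γ - ∫ z, inner ℝ (gradient ψ z.1) (z.2 - z.1) ∂γ := by
    simp only [inner_sub_left]
    exact integral_sub
      (integrable_inner_of_memLp_two
        (hξ.1.comp_measurePreserving hγ.measurePreserving_fst) hγ.memLp_sub)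
      (integrable_inner_of_memLp_two
        (hgψ.comp_measurePreserving hγ.measurePreserving_fst) hγ.memLp_sub)
  have b4 : L * transportCost γ ^ 2 ≤ η / 4 * (t' - t) := by
    calc L * transportCost γ ^ 2 ≤ L * (K * (t' - t)) ^ 2 := by gcongr
      _ = L * K ^ 2 * (t' - t) * (t' - t) := by ring
      _ ≤ _ := by gcongr
  have b5 : 2 * e * (K * (t' - t)) + 2 * e * Nv * (t' - t) ≤ η / 2 * (t' - t) := by
    calc _ = 2 * e * (K + Nv) * (t' - t) := by ring
      _ ≤ _ := by gcongr
  have b6 := mul_le_mul_of_nonneg_right hψv h0.le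
  rw [b3] at b2
  linarith

end ChainRule

/-! ### Comparison with an explicit supersolution. -/

section Comparison

theorem stepRatio_pos {t : ℝ} (ht : 0 < t) : 0 < stepRatio t :=
  lt_min one_pos (Real.rpow_pos_of_pos ht _)

theorem stepRatio_le_one (t : ℝ) : stepRatio t ≤ 1 := min_le_left _ _

theorem stepRatio_anti {s t : ℝ} (hs : 0 < s) (hst : s ≤ t) : stepRatio t ≤ stepRatio s :=
  min_le_min_left _ (Real.rpow_le_rpow_of_nonpos hs hst (by norm_num))

/-- Replaces `ε_t`, which has a kink at `t = 1`, by a smooth profile that can be differentiated. -/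
theorem stepRatio_le_mul_rpow {a t : ℝ} (ha : 1 ≤ a) (ht : 0 < t) :
    stepRatio t ≤ (a + 1) ^ (1 / 2 : ℝ) * (a + t) ^ (-(1 / 2) : ℝ) := by
  have e : (a + 1) ^ (1 / 2 : ℝ) * (a + t) ^ (-(1 / 2) : ℝ) =
      ((a + 1) / (a + t)) ^ (1 / 2 : ℝ) := by
    rw [Real.div_rpow (by positivity) (by positivity), Real.rpow_neg (by positivity)]
    rfl
  rw [e]
  rcases le_total t 1 with h | h
  · refine (min_le_left _ _).trans (Real.one_le_rpow ?_ (by norm_num))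
    rw [one_le_div (by positivity)]
    linarith
  · refine (min_le_right _ _).trans ?_
    rw [Real.rpow_neg ht.le, ← Real.inv_rpow ht.le]
    refine Real.rpow_le_rpow (by positivity) ?_ (by norm_num)
    rw [inv_eq_one_div, div_le_div_iff₀ ht (by positivity)]
    nlinarith

theorem hasDerivAt_exp_add_rpow (A c k a : ℝ) {t : ℝ} (h : 0 < a + t) :
    HasDerivAt (fun t => A * Real.exp (-c * t) + k * (a + t) ^ (-(1 / 2) : ℝ))
      (-c * (A * Real.exp (-c * t)) - k / 2 * (a + t) ^ (-(3 / 2) : ℝ)) t := by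
  have h1 : HasDerivAt (fun t => Real.exp (-c * t)) (Real.exp (-c * t) * (-c * 1)) t :=
    ((hasDerivAt_id' t).const_mul (-c)).exp
  have h2 : HasDerivAt (fun t => (a + t) ^ (-(1 / 2) : ℝ))
      (1 * (-(1 / 2) : ℝ) * (a + t) ^ ((-(1 / 2) : ℝ) - 1)) t :=
    ((hasDerivAt_id' t).const_add a).rpow_const (Or.inl h.ne')
  refine ((h1.const_mul A).add (h2.const_mul k)).congr_deriv ?_
  rw [show (-(1 / 2) : ℝ) - 1 = -(3 / 2) by norm_num]
  ring

/-- The amplitude of the algebraically decaying part in `le_exp_add_rpow_of_decay`. -/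
noncomputable def decayAmplitude (c K : ℝ) : ℝ := 2 * K * (1 + 1 / c + 1) ^ (1 / 2 : ℝ) / c + 1

theorem decayAmplitude_pos {c K : ℝ} (hc : 0 < c) (hK : 0 ≤ K) : 0 < decayAmplitude c K := by
  unfold decayAmplitude; positivity

/-- The right-hand side `U` is a positive supersolution of `y' = -c y + K ε_t`. Wherever `E > U`,
`E` is nonzero, so the hypotheses apply, and the damping is strictly stronger, so `E - U` cannot
increase. -/
theorem le_exp_add_rpow_of_decay {E m : ℝ → ℝ} {c K : ℝ} (hc : 0 < c) (hK : 0 ≤ K)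
    (hE : ∀ T, 0 ≤ T → ContinuousOn E (Icc 0 T)) (hE0 : 0 ≤ E 0)
    (hm0 : ∀ t, 0 ≤ m t) (hm : ∀ T, 0 ≤ T → IntervalIntegrable m volume 0 T)
    (hae : ∀ᵐ t, 0 < t → E t ≠ 0 → ∀ c', -c * E t + K * stepRatio t < c' →
      ∀ᶠ t' in 𝓝[>] t, E t' - E t ≤ c' * (t' - t))
    (hgrow : ∀ t, 0 < t → E t ≠ 0 →
      ∃ A : ℝ, ∀ᶠ t' in 𝓝[>] t, E t' - E t ≤ A * ∫ r in t..t', (m r + 1))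
    {T : ℝ} (hT : 0 ≤ T) :
    E T ≤ E 0 * Real.exp (-c * T) + decayAmplitude c K * (1 + 1 / c + T) ^ (-(1 / 2) : ℝ) := by
  set a := 1 + 1 / c with ha
  have hac : 0 < 1 / c := by positivity
  have ha1 : 1 ≤ a := by linarith
  set k := decayAmplitude c K with hk
  have hk0 : 0 < k := decayAmplitude_pos hc hK
  set U : ℝ → ℝ := fun t => E 0 * Real.exp (-c * t) + k * (a + t) ^ (-(1 / 2) : ℝ) with hU
  set U' : ℝ → ℝ := fun t => -c * (E 0 * Real.exp (-c * t)) - k / 2 * (a + t) ^ (-(3 / 2) : ℝ)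
    with hU'
  have hUd : ∀ t, 0 ≤ t → HasDerivAt U (U' t) t := fun t ht =>
    hasDerivAt_exp_add_rpow _ _ _ _ (by linarith)
  have hUpos : ∀ t, 0 ≤ t → 0 < U t := fun t ht => by
    have h1 : 0 < (a + t) ^ (-(1 / 2) : ℝ) := Real.rpow_pos_of_pos (by linarith) _
    have h2 := Real.exp_pos (-c * t)
    positivity
  have hUsuper : ∀ t, 0 < t → -c * U t + K * stepRatio t ≤ U' t := by
    intro t ht
    have hat : 0 < a + t := by linarith
    set r := (a + t) ^ (-(1 / 2) : ℝ) with hr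
    have hr0 : 0 < r := Real.rpow_pos_of_pos hat _
    have e1 : (a + t) ^ (-(3 / 2) : ℝ) = r * (a + t)⁻¹ := by
      rw [hr, ← Real.rpow_neg_one, ← Real.rpow_add hat]; norm_num
    -- The shift `a > 1 / c` makes the decay of the algebraic term consume at most half of its
    -- damping; `decayAmplitude` is chosen so that the other half dominates `K ε_t`.
    have e2 : (a + t)⁻¹ ≤ c := by
      rw [inv_le_comm₀ hat hc, ← one_div]; linarith
    have e3 := mul_le_mul_of_nonneg_left (stepRatio_le_mul_rpow ha1 ht) hK
    have e4 : c / 2 * k * r ≥ K * ((a + 1) ^ (1 / 2 : ℝ) * r) := by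
      have : c / 2 * k = K * (a + 1) ^ (1 / 2 : ℝ) + c / 2 := by
        rw [hk, decayAmplitude, ← ha]; field_simp
      rw [this]
      have : 0 < c / 2 * r := by positivity
      nlinarith
    have e5 : k / 2 * (r * (a + t)⁻¹) ≤ k / 2 * (r * c) := by gcongr
    simp only [hU, hU', e1]
    nlinarith
  by_contra hcon
  rw [not_le] at hcon
  change U T < E T at hcon
  have hUc : ContinuousOn U (Icc 0 T) := fun t ht =>
    (hUd t ht.1).continuousAt.continuousWithinAt
  have hfc : ContinuousOn (fun t => E t - U t) (Icc 0 T) := (hE T hT).sub hUc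
  -- If `E T > U T`, let `t₀` be the last time with `E ≤ U`. Monotonicity of `E - U` on `[t₀, T]`
  -- gives the contradiction.
  set s := Icc 0 T ∩ {t | E t - U t ≤ 0} with hs
  have hsc : IsClosed s := hfc.preimage_isClosed_of_isClosed isClosed_Icc isClosed_Iic
  have h0s : (0 : ℝ) ∈ s := by
    refine ⟨⟨le_rfl, hT⟩, ?_⟩
    have h1 : 0 < (a + 0) ^ (-(1 / 2) : ℝ) := Real.rpow_pos_of_pos (by linarith) _
    have h2 : 0 < k * (a + 0) ^ (-(1 / 2) : ℝ) := by positivity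
    simp only [hU, mem_ofPred_eq, mul_zero, Real.exp_zero]
    linarith
  have hsb : BddAbove s := ⟨T, fun t ht => ht.1.2⟩
  set t₀ := sSup s with ht₀
  have ht₀s : t₀ ∈ s := hsc.csSup_mem ⟨0, h0s⟩ hsb
  have ht₀0 : 0 ≤ t₀ := ht₀s.1.1
  have ht₀T : t₀ < T := by
    refine lt_of_le_of_ne ht₀s.1.2 fun h => ?_
    have := ht₀s.2
    rw [mem_ofPred_eq, h] at this
    linarith
  have hgt : ∀ t ∈ Ioo t₀ T, U t < E t := by
    intro t ht
    by_contra h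
    rw [not_lt] at h
    have : t ≤ t₀ := le_csSup hsb ⟨⟨ht₀0.trans ht.1.le, ht.2.le⟩, by
      rw [mem_ofPred_eq]; linarith⟩
    exact absurd ht.1 (not_lt.2 this)
  have hmi : ∀ x y, 0 ≤ x → x ≤ y → IntervalIntegrable m volume x y := fun x y hx hxy =>
    (hm y (hx.trans hxy)).mono_set (by
      rw [uIcc_of_le hxy, uIcc_of_le (hx.trans hxy)]; exact Icc_subset_Icc_left hx)
  have hfinal := le_of_ae_eventually_le_of_forall_growth (f := fun t => E t - U t)
    (k := fun t => m t + 1) ht₀T (hfc.mono (Icc_subset_Icc_left ht₀0))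
    ((intervalIntegrable_iff_integrableOn_Ioc_of_le ht₀T.le).1
      ((hmi t₀ T ht₀0 ht₀T.le).add intervalIntegrable_const))
    (fun t => by linarith [hm0 t]) ?_ ?_
  · have h1 : E t₀ - U t₀ ≤ 0 := ht₀s.2
    have h2 : E T - U T ≤ E t₀ - U t₀ := hfinal
    linarith
  · filter_upwards [hae] with t ht htI
    have htpos : 0 < t := ht₀0.trans_lt htI.1
    have hEU := hgt t htI
    have hlt : -c * E t + K * stepRatio t < U' t := by
      have := hUsuper t htpos
      nlinarith
    obtain ⟨c', h1, h2⟩ := exists_between hlt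
    filter_upwards [ht htpos ((hUpos t htpos.le).trans hEU).ne' c' h1,
      (hUd t htpos.le).neg.eventually_sub_le (c := -c') (by linarith)] with t' h3 h4
    simp only [Pi.neg_apply] at h4
    linarith
  · intro t htI
    have htpos : 0 < t := ht₀0.trans_lt htI.1
    obtain ⟨A, hA⟩ := hgrow t htpos ((hUpos t htpos.le).trans (hgt t htI)).ne'
    refine ⟨A + (|U' t| + 1), ?_⟩
    filter_upwards [hA, (hUd t htpos.le).neg.eventually_sub_le (c := |U' t| + 1)
      (by linarith [neg_abs_le (U' t)]), self_mem_nhdsWithin] with t' h1 h2 h3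
    -- The summand `1` in `m r + 1` lets the same primitive control the variation of `U`.
    have h4 : t' - t ≤ ∫ r in t..t', (m r + 1) := by
      rw [intervalIntegral.integral_add (hmi t t' htpos.le (le_of_lt h3)) intervalIntegrable_const]
      have : 0 ≤ ∫ r in t..t', m r :=
        intervalIntegral.integral_nonneg (le_of_lt h3) fun u _ => hm0 u
      simp only [intervalIntegral.integral_const, smul_eq_mul, mul_one]
      linarith
    have h5 := mul_le_mul_of_nonneg_left h4 (show 0 ≤ |U' t| + 1 by positivity)
    simp only [Pi.neg_apply] at h2
    rw [add_mul]
    linarith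

end Comparison

/-! ### First-order growth of the divergence. -/

section DivergenceAlongFlow

variable {n : ℕ}

/-- Freeze the second argument (`s = 0`) and restrict to optimal couplings. This is what makes the
PL and mismatch hypotheses applicable to `ξ`. -/
theorem HasDivDerivAt.hasWGradient {D : P2 n → P2 n → ℝ} {μ ν : P2 n} {ξ : Euc n → Euc n}
    {φ : Euc n → ℝ} (h : HasDivDerivAt D μ ν ξ φ) : HasWGradient (fun μ' => D μ' ν) μ ξ := by
  have key : ∀ η : ℝ, 0 < η → ∃ δ : ℝ, 0 < δ ∧ ∀ μ' : P2 n, W2 μ μ' < δ →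
      ∀ γ : Measure (Euc n × Euc n), IsOptimalCoupling γ μ μ' →
        |D μ' ν - D μ ν - ∫ z, inner ℝ (ξ z.1) (z.2 - z.1) ∂γ| ≤ η * W2 μ μ' := by
    intro η hη
    obtain ⟨δ, hδ, hδ'⟩ := h.2.2 η hη
    refine ⟨δ, hδ, fun μ' hμ' γ hγ => ?_⟩
    have h1 := hδ' μ' ν γ 0 hγ.1 (hγ.2 ▸ hμ') le_rfl hδ (by simp [RelClose])
    simpa [hγ.2] using h1
  refine ⟨h.1, ⟨h.1.1, fun η hη => ?_⟩, ⟨h.1.1.neg, fun η hη => ?_⟩⟩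
  · obtain ⟨δ, hδ, hδ'⟩ := key η hη
    refine ⟨δ, hδ, fun μ' hμ' γ hγ => ?_⟩
    have := abs_le.1 (hδ' μ' hμ' γ hγ)
    linarith
  · obtain ⟨δ, hδ, hδ'⟩ := key η hη
    refine ⟨δ, hδ, fun μ' hμ' γ hγ => ?_⟩
    have := abs_le.1 (hδ' μ' hμ' γ hγ)
    simp only [inner_neg_left, integral_neg]
    linarith

theorem integral_abs_le_of_eLpNorm_two_le {Ω : Type*} [MeasurableSpace Ω] {μ : Measure Ω}
    [IsProbabilityMeasure μ] {φ : Ω → ℝ} (hφ : MemLp φ 2 μ) {C : ℝ}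
    (h : eLpNorm φ 2 μ ≤ ENNReal.ofReal C) : ∫ x, |φ x| ∂μ ≤ max C 0 := by
  have h1 : ∫ x, ‖φ x‖ ∂μ = (eLpNorm φ 1 μ).toReal := by
    rw [eLpNorm_one_eq_lintegral_enorm, integral_norm_eq_lintegral_enorm hφ.1]
  change ∫ x, ‖φ x‖ ∂μ ≤ _
  rw [h1, ← ENNReal.toReal_ofReal']
  exact ENNReal.toReal_mono ENNReal.ofReal_ne_top
    ((eLpNorm_le_eLpNorm_of_exponent_le (by norm_num) hφ.1).trans h)

theorem eventually_exp_sub_one_le {E : Type*} [NormedAddCommGroup E] [NormedSpace ℝ E]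
    {θ : ℝ → E} {θ' : E} {t C B c : ℝ} (hC : 0 ≤ C) (h : HasDerivAt θ θ' t)
    (hB : ‖θ'‖ ≤ B) (hc : C * B < c) :
    ∀ᶠ t' in 𝓝[>] t, Real.exp (C * ‖θ t' - θ t‖) - 1 ≤ c * (t' - t) := by
  obtain ⟨B', hB1, hB2⟩ : ∃ B', B < B' ∧ C * B' < c := by
    refine ⟨B + (c - C * B) / (C + 1) / 2, ?_, ?_⟩
    · have : 0 < (c - C * B) / (C + 1) / 2 := by
        have : 0 < c - C * B := by linarith
        positivity
      linarith
    · have h1 : 0 < c - C * B := by linarith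
      have h2 : C / (C + 1) ≤ 1 := by
        rw [div_le_one (by positivity)]; linarith
      have h3 : C * ((c - C * B) / (C + 1) / 2) = C / (C + 1) * (c - C * B) / 2 := by ring
      rw [mul_add, h3]
      nlinarith
  have h1 := (h.hasDerivWithinAt (s := Ioi t)).limsup_norm_slope_le (hB.trans_lt hB1)
  have h2 : HasDerivAt (fun t' => Real.exp (C * B' * (t' - t))) (C * B') t := by
    have := (((hasDerivAt_id' t).sub_const t).const_mul (C * B')).exp
    simpa using this
  filter_upwards [h1, h2.eventually_sub_le hB2, self_mem_nhdsWithin] with t' h3 h4 h5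
  have h6 : 0 < t' - t := sub_pos.2 h5
  rw [Real.norm_of_nonneg h6.le, inv_mul_lt_iff₀ h6] at h3
  refine le_trans ?_ h4
  simp only [sub_self, mul_zero, Real.exp_zero]
  have : C * ‖θ t' - θ t‖ ≤ C * B' * (t' - t) := by nlinarith
  linarith [Real.exp_le_exp.2 this]

/-- The sharp bound, for times with finite metric speed: `a` is the contribution of the moving
measure and `b * c` that of the moving target. -/
theorem HasDivDerivAt.eventually_sub_le {D : P2 n → P2 n → ℝ} {μ ν : ℝ → P2 n} {t : ℝ}
    {ξ : Euc n → Euc n} {φ : Euc n → ℝ} (h : HasDivDerivAt D (μ t) (ν t) ξ φ)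
    {S : ℝ → ℝ} {a b c c' K : ℝ} (hK : 0 ≤ K) (hb : 0 ≤ b)
    (hS : ∀ᶠ t' in 𝓝[>] t, 0 ≤ S t' ∧ S t' ≤ b * (t' - t) ∧ RelClose (S t') (ν t) (ν t'))
    (hW : ∀ᶠ t' in 𝓝[>] t, W2 (μ t) (μ t') ≤ K * (t' - t))
    (hchain : ∀ η, 0 < η → ∀ᶠ t' in 𝓝[>] t, ∀ γ, IsCoupling γ (μ t) (μ t') →
      transportCost γ ≤ (K + 1) * (t' - t) →
        ∫ z, inner ℝ (ξ z.1) (z.2 - z.1) ∂γ ≤ (a + η) * (t' - t))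
    (hφ : ∫ x, |φ x| ∂(ν t).1 ≤ c) (hc' : a + b * c < c') :
    ∀ᶠ t' in 𝓝[>] t, D (μ t') (ν t') - D (μ t) (ν t) ≤ c' * (t' - t) := by
  have hp := (ν t).2.1
  have hc0 : 0 ≤ c := (integral_nonneg fun _ => abs_nonneg _).trans hφ
  set e := (c' - (a + b * c)) / 2 with he
  have he0 : 0 < e := by rw [he]; linarith
  set η := e / (K + 1 + b) with hη
  have hη0 : 0 < η := by positivity
  have hηe : η * (K + 1 + b) = e := by rw [hη]; field_simp
  obtain ⟨δ, hδ, hδ'⟩ := h.2.2 η hη0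
  have hsmall : ∀ᶠ t' in 𝓝[>] t, (K + 1 + b) * (t' - t) < δ := by
    have hc : Continuous fun t' => (K + 1 + b) * (t' - t) := by fun_prop
    have := hc.tendsto t
    rw [sub_self, mul_zero] at this
    exact (this.mono_left nhdsWithin_le_nhds).eventually_lt_const hδ
  filter_upwards [hS, hW, hchain e he0, hsmall, self_mem_nhdsWithin] with t' h1 h2 h3 h4 h5
  have h6 : 0 < t' - t := sub_pos.2 h5
  -- The slack `t' - t` in the cost is of the order of the increment, whence `K + 1` in `hchain`.
  obtain ⟨γ, hγ, hγc⟩ := exists_isCoupling_transportCost_lt (μ t) (μ t') h6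
  have hγK : transportCost γ ≤ (K + 1) * (t' - t) := by linarith
  have hbh : 0 ≤ b * (t' - t) := by positivity
  have hKh : 0 ≤ (K + 1) * (t' - t) := by positivity
  have k1 := (abs_le.1 (hδ' (μ t') (ν t') γ (S t') hγ (by linarith) h1.1 (by linarith) h1.2.2)).2
  have k2 := h3 γ hγ hγK
  have k3 := (abs_le.1 (h1.2.2.abs_integral_sub_le h1.1 (h.2.1.integrable (by norm_num)))).2
  have k4 : S t' * ∫ x, |φ x| ∂(ν t).1 ≤ b * (t' - t) * c :=
    mul_le_mul h1.2.1 hφ (integral_nonneg fun _ => abs_nonneg _) hbh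
  have k5 : η * (transportCost γ + S t') ≤ e * (t' - t) := by
    calc _ ≤ η * ((K + 1) * (t' - t) + b * (t' - t)) := by gcongr; exact h1.2.1
      _ = η * (K + 1 + b) * (t' - t) := by ring
      _ = _ := by rw [hηe]
  have k6 : c' * (t' - t) = (a + e) * (t' - t) + b * (t' - t) * c + e * (t' - t) := by
    rw [he]; ring
  linarith

/-- The crude bound, for times where the metric speed need not exist: Cauchy–Schwarz for `ξ`, `L¹`
for `φ`, and the expansion with tolerance `1`, all measured by `Λ`. -/
theorem HasDivDerivAt.exists_eventually_sub_le {D : P2 n → P2 n → ℝ} {μ ν : ℝ → P2 n} {t : ℝ}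
    {ξ : Euc n → Euc n} {φ : Euc n → ℝ} (h : HasDivDerivAt D (μ t) (ν t) ξ φ)
    {S Λ : ℝ → ℝ} {b : ℝ} (hb : 0 ≤ b)
    (hS : ∀ᶠ t' in 𝓝[>] t, 0 ≤ S t' ∧ S t' ≤ b * (t' - t) ∧ RelClose (S t') (ν t) (ν t'))
    (hW : ∀ᶠ t' in 𝓝[>] t, W2 (μ t) (μ t') + (t' - t) ≤ Λ t')
    (hΛ : Tendsto Λ (𝓝[>] t) (𝓝 0)) :
    ∃ A : ℝ, ∀ᶠ t' in 𝓝[>] t, D (μ t') (ν t') - D (μ t) (ν t) ≤ A * Λ t' := by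
  have hp := (ν t).2.1
  set N := √(∫ x, ‖ξ x‖ ^ 2 ∂(μ t).1) with hN
  set c := ∫ x, |φ x| ∂(ν t).1 with hc
  have hN0 : 0 ≤ N := Real.sqrt_nonneg _
  have hc0 : 0 ≤ c := integral_nonneg fun _ => abs_nonneg _
  refine ⟨N + b * c + 1 + b, ?_⟩
  obtain ⟨δ, hδ, hδ'⟩ := h.2.2 1 one_pos
  have hbΛ : Tendsto (fun t' => b * Λ t') (𝓝[>] t) (𝓝 0) := by simpa using hΛ.const_mul b
  filter_upwards [hS, hW, hΛ.eventually_lt_const hδ, hbΛ.eventually_lt_const hδ,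
    self_mem_nhdsWithin] with t' h1 h2 h3 h4 h5
  have h6 : 0 < t' - t := sub_pos.2 h5
  have hW0 := W2_nonneg (μ t) (μ t')
  obtain ⟨γ, hγ, hγc⟩ := exists_isCoupling_transportCost_lt (μ t) (μ t') h6
  have hγΛ : transportCost γ ≤ Λ t' := by linarith
  have hSΛ : S t' ≤ b * Λ t' := h1.2.1.trans (mul_le_mul_of_nonneg_left (by linarith) hb)
  have k1 := (abs_le.1 (hδ' (μ t') (ν t') γ (S t') hγ (by linarith) h1.1 (by linarith) h1.2.2)).2
  have k2 := (abs_le.1 (hγ.abs_integral_inner_le h.1.1)).2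
  have k3 := (abs_le.1 (h1.2.2.abs_integral_sub_le h1.1 (h.2.1.integrable (by norm_num)))).2
  have k4 : S t' * c ≤ b * Λ t' * c := mul_le_mul_of_nonneg_right hSΛ hc0
  have k5 : N * transportCost γ ≤ N * Λ t' := mul_le_mul_of_nonneg_left hγΛ hN0
  linarith

end DivergenceAlongFlow

/-! ### Decay of the divergence along the inner flow. -/

section FlowEstimate

variable {n w : ℕ}

theorem IsWGradientFlow.exists_nonneg_speed {G : ℝ → P2 n → ℝ} {μ : ℝ → P2 n}
    {v : ℝ → Euc n → Euc n} (h : IsWGradientFlow G μ v) :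
    ∃ m : ℝ → ℝ, (∀ t, 0 ≤ m t) ∧ (∀ T : ℝ, 0 ≤ T → IntervalIntegrable m volume 0 T) ∧
      ∀ s t : ℝ, 0 ≤ s → s ≤ t → W2 (μ s) (μ t) ≤ ∫ r in s..t, m r := by
  obtain ⟨m, hm, hW⟩ := h.absolutelyContinuous
  refine ⟨fun t => |m t|, fun t => abs_nonneg _, fun T hT => (hm T hT).abs, fun s t hs hst => ?_⟩
  refine (hW s t hs hst).trans ?_
  exact (le_abs_self _).trans (intervalIntegral.abs_integral_le_integral_abs hst)

theorem continuousOn_div_of_flow {D : P2 n → P2 n → ℝ} (hDcont : ∀ μ ν, DivContinuousAt D μ ν)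
    {U : Euc n → Euc w → ℝ} {C : ℝ}
    (hU : ContDiff ℝ 1 (fun z : Euc n × Euc w => U z.1 z.2))
    (hC : ∀ x θ, ‖gradient (U x) θ‖ ≤ C) {ν : Euc w → P2 n} (hν : IsGibbsFamily U ν)
    {θ : ℝ → Euc w} (hθ : ContinuousOn θ (Ici 0)) {μ : ℝ → P2 n} {m : ℝ → ℝ}
    (hm : ∀ T : ℝ, 0 ≤ T → IntervalIntegrable m volume 0 T)
    (hW : ∀ s t : ℝ, 0 ≤ s → s ≤ t → W2 (μ s) (μ t) ≤ ∫ r in s..t, m r) {T : ℝ} (hT : 0 ≤ T) :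
    ContinuousOn (fun t => D (μ t) (ν (θ t))) (Icc 0 T) := by
  intro t ht
  have hC0 : 0 ≤ C := (norm_nonneg _).trans (hC 0 (θ t))
  have hI : ContinuousOn (fun x => ∫ r in (0 : ℝ)..x, m r) (Icc 0 T) := by
    have := intervalIntegral.continuousOn_primitive_interval' (hm T hT)
      (show (0 : ℝ) ∈ uIcc 0 T from left_mem_uIcc)
    rwa [uIcc_of_le hT] at this
  have hII : ∀ x ∈ Icc (0 : ℝ) T, IntervalIntegrable m volume 0 x := fun x hx => hm x hx.1
  have hW' : ∀ t' ∈ Icc 0 T, W2 (μ t) (μ t') ≤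
      |(∫ r in (0 : ℝ)..t', m r) - ∫ r in (0 : ℝ)..t, m r| := by
    intro t' ht'
    rcases le_total t t' with h | h
    · refine (hW t t' ht.1 h).trans ?_
      rw [intervalIntegral.integral_interval_sub_left (hII t' ht') (hII t ht)]
      exact le_abs_self _
    · rw [W2_comm, abs_sub_comm]
      refine (hW t' t ht'.1 h).trans ?_
      rw [intervalIntegral.integral_interval_sub_left (hII t ht) (hII t' ht')]
      exact le_abs_self _
  rw [ContinuousWithinAt, Metric.tendsto_nhds]
  intro ε hε
  obtain ⟨δ, hδ, hδ'⟩ := hDcont (μ t) (ν (θ t)) (ε / 2) (half_pos hε)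
  have h1 : ∀ᶠ t' in 𝓝[Icc 0 T] t, |(∫ r in (0 : ℝ)..t', m r) - ∫ r in (0 : ℝ)..t, m r| < δ := by
    have := Metric.tendsto_nhds.1 (hI t ht) δ hδ
    simpa [Real.dist_eq] using this
  have h2 : ∀ᶠ t' in 𝓝[Icc 0 T] t, Real.exp (2 * C * ‖θ t' - θ t‖) - 1 < δ :=
    ((tendsto_exp_mul_norm_sub_one (2 * C) (θ t)).comp
      ((hθ t ht.1).mono_left (nhdsWithin_mono _ Icc_subset_Ici_self))).eventually_lt_const hδ
  filter_upwards [h1, h2, self_mem_nhdsWithin] with t' h3 h4 h5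
  have h6 : 0 ≤ Real.exp (2 * C * ‖θ t' - θ t‖) - 1 := by
    have := Real.one_le_exp (x := 2 * C * ‖θ t' - θ t‖) (by positivity)
    linarith
  rw [Real.dist_eq]
  exact (hδ' _ _ _ ((hW' t' h5).trans_lt h3) h6 h4 (hν.relClose hU hC _ _)).trans_lt
    (half_lt_self hε)

/-- Expand `‖v + ξ‖²` and discard `-½‖v‖²`. -/
theorem integral_inner_le_of_mismatch {Ω E : Type*} [MeasurableSpace Ω] {μ : Measure Ω}
    [NormedAddCommGroup E] [InnerProductSpace ℝ E] {ξ v : Ω → E}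
    (hξ : MemLp ξ 2 μ) (hv : MemLp v 2 μ) :
    ∫ x, inner ℝ (ξ x) (v x) ∂μ ≤ -(1 / 2) * ∫ x, ‖ξ x‖ ^ 2 ∂μ
      + 1 / 2 * ∫ x, ‖-v x - ξ x‖ ^ 2 ∂μ := by
  have i1 : Integrable (fun x => ‖ξ x‖ ^ 2) μ := hξ.integrable_norm_pow (by norm_num)
  have i2 : Integrable (fun x => ‖-v x - ξ x‖ ^ 2) μ :=
    (hv.neg.sub hξ).integrable_norm_pow (by norm_num)
  rw [← integral_const_mul, ← integral_const_mul, ← integral_add (i1.const_mul _) (i2.const_mul _)]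
  refine integral_mono (integrable_inner_of_memLp_two hξ hv)
    ((i1.const_mul _).add (i2.const_mul _)) fun x => ?_
  have h1 : ‖-v x - ξ x‖ ^ 2 = ‖v x‖ ^ 2 + 2 * inner ℝ (ξ x) (v x) + ‖ξ x‖ ^ 2 := by
    rw [← norm_neg, neg_sub, sub_neg_eq_add, norm_add_sq_real]; ring
  simp only [h1]
  nlinarith [sq_nonneg ‖v x‖]

/-- The PL inequality gives damping at rate `1 / (2 * (C_PL + 1))`, where the `+ 1` covers `C_PL =
0`. The forcing adds half the mismatch bound and the target's relative speed `2 * C * B` times the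
bound on `φ`. -/
theorem div_le_exp_add_rpow_of_flow {D : P2 n → P2 n → ℝ} (hD0 : ∀ μ ν, 0 ≤ D μ ν)
    (hDcont : ∀ μ ν, DivContinuousAt D μ ν) {U : Euc n → Euc w → ℝ} {C : ℝ}
    (hU : ContDiff ℝ 1 (fun z : Euc n × Euc w => U z.1 z.2))
    (hC : ∀ x θ, ‖gradient (U x) θ‖ ≤ C) {ν : Euc w → P2 n} (hν : IsGibbsFamily U ν)
    {θ θ' : ℝ → Euc w} {B : ℝ} (hB : 0 ≤ B) (hθc : ContinuousOn θ (Ici 0))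
    (hθ : ∀ t, 0 < t → HasDerivAt θ (θ' t) t) (hθB : ∀ t, 0 < t → ‖θ' t‖ ≤ B * stepRatio t)
    {G : ℝ → P2 n → ℝ} {μ : ℝ → P2 n} {v : ℝ → Euc n → Euc n} (hflow : IsWGradientFlow G μ v)
    {C_F M C_PL : ℝ} (hdiff : ∀ t, 0 ≤ t → D (μ t) (ν (θ t)) ≠ 0 →
      ∃ ξ φ, HasDivDerivAt D (μ t) (ν (θ t)) ξ φ ∧
        eLpNorm φ 2 (ν (θ t)).1 ≤ ENNReal.ofReal C_F)
    (hM : 0 < M)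
    (hmis : ∀ᵐ t ∂(volume.restrict (Ioi (0 : ℝ))), D (μ t) (ν (θ t)) ≠ 0 →
      ∀ ξ, HasWGradient (fun μ' => D μ' (ν (θ t))) (μ t) ξ →
        ∫ x, ‖-v t x - ξ x‖ ^ 2 ∂(μ t).1 ≤ M * stepRatio t)
    (hC_PL : 0 ≤ C_PL)
    (hPL : ∀ θ μ ξ, HasWGradient (fun μ' => D μ' (ν θ)) μ ξ →
      D μ (ν θ) ≤ C_PL * ∫ x, ‖ξ x‖ ^ 2 ∂μ.1) {T : ℝ} (hT : 0 ≤ T) :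
    D (μ T) (ν (θ T)) ≤ D (μ 0) (ν (θ 0)) * Real.exp (-(1 / (2 * (C_PL + 1))) * T) +
      decayAmplitude (1 / (2 * (C_PL + 1))) (M / 2 + 2 * C * B * max C_F 0) *
        (1 + 1 / (1 / (2 * (C_PL + 1))) + T) ^ (-(1 / 2) : ℝ) := by
  have hC0 : 0 ≤ C := (norm_nonneg _).trans (hC 0 0)
  obtain ⟨m, hm0, hm, hW⟩ := hflow.exists_nonneg_speed
  obtain ⟨Ψ, hΨc, hΨ, hΨd⟩ := exists_countable_dense_gradients n
  have hmi : ∀ x y, 0 ≤ x → x ≤ y → IntervalIntegrable m volume x y := fun x y hx hxy =>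
    (hm y (hx.trans hxy)).mono_set (by
      rw [uIcc_of_le hxy, uIcc_of_le (hx.trans hxy)]; exact Icc_subset_Icc_left hx)
  have hS : ∀ t, 0 < t → ∀ b, 2 * C * (B * stepRatio t) < b → ∀ᶠ t' in 𝓝[>] t,
      0 ≤ Real.exp (2 * C * ‖θ t' - θ t‖) - 1 ∧
      Real.exp (2 * C * ‖θ t' - θ t‖) - 1 ≤ b * (t' - t) ∧
      RelClose (Real.exp (2 * C * ‖θ t' - θ t‖) - 1) (ν (θ t)) (ν (θ t')) := by
    intro t ht b hb
    filter_upwards [eventually_exp_sub_one_le (by positivity) (hθ t ht) (hθB t ht) hb] with t' h1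
    refine ⟨?_, h1, hν.relClose hU hC _ _⟩
    have := Real.one_le_exp (x := 2 * C * ‖θ t' - θ t‖) (by positivity)
    linarith
  refine le_exp_add_rpow_of_decay (E := fun t => D (μ t) (ν (θ t))) (m := m) (by positivity)
    (by positivity)
    (fun T hT => continuousOn_div_of_flow hDcont hU hC hν hθc hm hW hT) (hD0 _ _) hm0 hm ?_ ?_ hT
  · have hΨae : ∀ᵐ t, ∀ ψ ∈ Ψ, 0 < t → HasDerivAt (fun s => ∫ r in (0 : ℝ)..s,
        ∫ x, inner ℝ (gradient ψ x) (v r x) ∂(μ r).1)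
        (∫ x, inner ℝ (gradient ψ x) (v t x) ∂(μ t).1) t :=
      (ae_ball_iff hΨc).2 fun ψ hψ => ae_hasDerivAt_integral_of_forall_intervalIntegrable
        fun T hT => (hflow.continuityEquation ψ (hΨ ψ hψ).1 (hΨ ψ hψ).2 T hT).1
    filter_upwards [hΨae, ae_hasDerivAt_integral_of_forall_intervalIntegrable hm,
      (ae_restrict_iff' measurableSet_Ioi).1 hmis,
      (ae_restrict_iff' measurableSet_Ioi).1 hflow.velocity] with t h1 h2 h3 h4 ht hE c' hc'
    obtain ⟨ξ, φ, hd, hφ⟩ := hdiff t ht.le hE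
    have hp := (ν (θ t)).2.1
    have hv : MemLp (v t) 2 (μ t).1 := (h4 ht).1.1
    have hgrad := hd.hasWGradient
    have hmis' := h3 ht hE ξ hgrad
    have hPL' := hPL (θ t) (μ t) ξ hgrad
    have hin := integral_inner_le_of_mismatch hd.1.1 hv
    set a := ∫ x, inner ℝ (ξ x) (v t x) ∂(μ t).1 with ha
    have haE : a ≤ -(1 / (2 * (C_PL + 1))) * D (μ t) (ν (θ t)) + M / 2 * stepRatio t := by
      have hI : 0 ≤ ∫ x, ‖ξ x‖ ^ 2 ∂(μ t).1 := integral_nonneg fun x => by positivity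
      have h5 : 1 / (2 * (C_PL + 1)) * D (μ t) (ν (θ t)) ≤ 1 / 2 * ∫ x, ‖ξ x‖ ^ 2 ∂(μ t).1 := by
        rw [one_div_mul_eq_div, div_le_iff₀ (by positivity)]
        nlinarith
      linarith
    have hε := stepRatio_pos ht
    set cF := max C_F 0 with hcF
    have hcF0 : 0 ≤ cF := le_max_right _ _
    set g := c' - (-(1 / (2 * (C_PL + 1))) * D (μ t) (ν (θ t)) +
      (M / 2 + 2 * C * B * cF) * stepRatio t) with hg
    have hg0 : 0 < g := sub_pos.2 hc'
    -- Slack in the speed of the target, small enough that its effect `e * cF` stays below the gap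
    -- `g`.
    set e := g / (2 * (cF + 1)) with he
    have he0 : 0 < e := by positivity
    have hecF : e * cF < g := by
      have : e * (2 * (cF + 1)) = g := by rw [he]; field_simp
      nlinarith
    have hWt : ∀ᶠ t' in 𝓝[>] t, W2 (μ t) (μ t') ≤ (m t + 1) * (t' - t) := by
      filter_upwards [(h2 ht).eventually_sub_le (lt_add_one (m t)), self_mem_nhdsWithin]
        with t' h5 h6
      have htt' : t ≤ t' := le_of_lt h6
      refine (hW t t' ht.le htt').trans ?_
      rwa [intervalIntegral.integral_interval_sub_left (hm t' (ht.le.trans htt')) (hm t ht.le)]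
        at h5
    have hmt := hm0 t
    refine hd.eventually_sub_le (ν := fun t => ν (θ t)) (a := a) (c := cF)
      (b := 2 * C * (B * stepRatio t) + e) (K := m t + 1) (by positivity) (by positivity)
      (hS t ht _ (by linarith)) hWt ?_ (integral_abs_le_of_eLpNorm_two_le hd.2.1 hφ) ?_
    · intro η hη
      refine eventually_integral_inner_le hΨ hΨd hv ?_ hd.1 (by positivity) hη
      intro ψ hψ c hc
      filter_upwards [(h1 ψ hψ ht).eventually_sub_le hc, self_mem_nhdsWithin] with t' h5 h6
      have htt' : t ≤ t' := le_of_lt h6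
      have e1 := (hflow.continuityEquation ψ (hΨ ψ hψ).1 (hΨ ψ hψ).2 t ht.le).2
      have e2 := (hflow.continuityEquation ψ (hΨ ψ hψ).1 (hΨ ψ hψ).2 t' (ht.le.trans htt')).2
      linarith
    · have : c' = g + (-(1 / (2 * (C_PL + 1))) * D (μ t) (ν (θ t)) +
        (M / 2 + 2 * C * B * cF) * stepRatio t) := by rw [hg]; ring
      rw [this]
      linarith
  · intro t ht hE
    obtain ⟨ξ, φ, hd, -⟩ := hdiff t ht.le hE
    have hε := stepRatio_pos ht
    refine hd.exists_eventually_sub_le (ν := fun t => ν (θ t))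
      (b := 2 * C * (B * stepRatio t) + 1) (by positivity) (hS t ht _ (by linarith)) ?_ ?_
    · filter_upwards [self_mem_nhdsWithin] with t' h6
      have htt' : t ≤ t' := le_of_lt h6
      rw [intervalIntegral.integral_add (hmi t t' ht.le htt') intervalIntegrable_const]
      simpa using hW t t' ht.le htt'
    · have hI : IntervalIntegrable (fun r => m r + 1) volume t (t + 1) :=
        (hmi t (t + 1) ht.le (by linarith)).add intervalIntegrable_const
      have h1 := intervalIntegral.continuousOn_primitive_interval' hI
        (show t ∈ uIcc t (t + 1) from left_mem_uIcc)
      rw [uIcc_of_le (by linarith)] at h1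
      have h2 := (h1 t ⟨le_rfl, by linarith⟩).mono_left
        (nhdsWithin_mono t (Ioo_subset_Icc_self (a := t) (b := t + 1)))
      rw [nhdsWithin_Ioo_eq_nhdsGT (by linarith)] at h2
      simpa using h2

end FlowEstimate

/-! ### Descent for the outer loss and the averaged rate. -/

section Descent

variable {w : ℕ}

/-- `∇L` is not assumed continuous, but a derivative is Borel measurable, and this one is bounded.
-/
theorem intervalIntegrable_sq_norm_gradient {L : Euc w → ℝ} {C : ℝ}
    (hC : ∀ θ, ‖gradient L θ‖ ≤ C) {θ : ℝ → Euc w} (hθ : ContinuousOn θ (Ici 0)) {T : ℝ}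
    (hT : 0 ≤ T) : IntervalIntegrable (fun t => ‖gradient L (θ t)‖ ^ 2) volume 0 T := by
  rw [intervalIntegrable_iff_integrableOn_Ioc_of_le hT]
  have hm : Measurable (gradient L) :=
    (InnerProductSpace.toDual ℝ (Euc w)).symm.continuous.measurable.comp (measurable_fderiv ℝ L)
  have hθm : AEMeasurable θ (volume.restrict (Ioc 0 T)) :=
    (hθ.mono (Ioc_subset_Icc_self.trans Icc_subset_Ici_self)).aemeasurable measurableSet_Ioc
  refine Integrable.of_bound
    ((hm.comp_aemeasurable hθm).norm.pow_const 2).aestronglyMeasurable (C ^ 2)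
    (.of_forall fun t => ?_)
  rw [Real.norm_of_nonneg (by positivity)]
  exact pow_le_pow_left₀ (norm_nonneg _) (hC _) 2

/-- `L(θ_t) + W(t)` is a Lyapunov function: polarization of `⟨∇L, g⟩` leaves the gradient error,
which `W'` absorbs. Since `ε` is nonincreasing, `ε_t` may be replaced by `ε_T`. -/
theorem integral_sq_norm_gradient_le_of_descent {L : Euc w → ℝ} (hL : Differentiable ℝ L) {b : ℝ}
    (hb : ∀ θ, b ≤ L θ) {C : ℝ} (hC : ∀ θ, ‖gradient L θ‖ ≤ C) {θ g : ℝ → Euc w}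
    (hθ : SolvesOuter θ g) {W W' : ℝ → ℝ} (hW0 : ∀ t, 0 ≤ t → 0 ≤ W t)
    (hW : ∀ t, 0 ≤ t → HasDerivAt W (W' t) t)
    (hgW : ∀ t, 0 < t → stepRatio t / 2 * ‖g t - gradient L (θ t)‖ ^ 2 ≤ -W' t)
    {T : ℝ} (hT : 0 < T) :
    stepRatio T / 2 * ∫ t in (0 : ℝ)..T, ‖gradient L (θ t)‖ ^ 2 ≤ L (θ 0) + W 0 - b := by
  have hint := intervalIntegrable_sq_norm_gradient hC hθ.1 hT.le
  have hd : ∀ t, 0 < t → HasDerivAt (fun t => L (θ t) + W t)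
      (inner ℝ (gradient L (θ t)) (-(stepRatio t • g t)) + W' t) t := by
    intro t ht
    have h1 := (hL (θ t)).hasFDerivAt.comp_hasDerivAt t (hθ.2 t ht)
    have h2 : ∀ x u, inner ℝ (gradient L x) u = fderiv ℝ L x u := fun x u => by simp [gradient]
    rw [h2]
    exact h1.add (hW t ht.le)
  have hle := intervalIntegral.sub_le_integral_of_hasDeriv_right_of_le hT.le
    (g := fun t => L (θ t) + W t) (φ := fun t => -(stepRatio T / 2) * ‖gradient L (θ t)‖ ^ 2)
    ?_ (fun t ht => (hd t ht.1).hasDerivWithinAt) ?_ ?_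
  · rw [intervalIntegral.integral_const_mul] at hle
    have h1 := hb (θ T)
    have h2 := hW0 T hT.le
    linarith
  · refine (hL.continuous.comp_continuousOn (hθ.1.mono Icc_subset_Ici_self)).add ?_
    exact fun t ht => (hW t ht.1).continuousAt.continuousWithinAt
  · have := (intervalIntegrable_iff_integrableOn_Icc_of_le hT.le).1 hint
    exact this.const_mul _
  · intro t ht
    have h1 := hgW t ht.1
    have h2 := stepRatio_anti ht.1 ht.2.le
    have h3 := stepRatio_pos ht.1
    have h4 : ‖g t - gradient L (θ t)‖ ^ 2 = ‖g t‖ ^ 2 - 2 * inner ℝ (gradient L (θ t)) (g t)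
        + ‖gradient L (θ t)‖ ^ 2 := by
      rw [norm_sub_sq_real, real_inner_comm]
    rw [inner_neg_right, inner_smul_right]
    rw [h4] at h1
    have h5 : 0 ≤ stepRatio t * ‖g t‖ ^ 2 := by positivity
    have h6 : stepRatio T * ‖gradient L (θ t)‖ ^ 2 ≤ stepRatio t * ‖gradient L (θ t)‖ ^ 2 := by
      gcongr
    linarith

theorem stepRatio_of_one_le {T : ℝ} (hT : 1 ≤ T) : stepRatio T = 1 / √T := by
  have h0 : 0 ≤ T := by linarith
  have e : T ^ (-(1 / 2) : ℝ) = 1 / √T := by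
    rw [Real.rpow_neg h0, ← Real.sqrt_eq_rpow, one_div]
  rw [stepRatio, e, min_eq_right]
  rw [div_le_one (by positivity)]
  exact Real.one_le_sqrt.2 hT

theorem averageGradientRate_of_descent {L : Euc w → ℝ} (hL : Differentiable ℝ L)
    (hLb : BddBelow (range L)) {C : ℝ} (hC : ∀ θ, ‖gradient L θ‖ ≤ C) {θ g : ℝ → Euc w}
    (hθ : SolvesOuter θ g) {W W' : ℝ → ℝ} (hW0 : ∀ t, 0 ≤ t → 0 ≤ W t)
    (hW : ∀ t, 0 ≤ t → HasDerivAt W (W' t) t)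
    (hgW : ∀ t, 0 < t → stepRatio t / 2 * ‖g t - gradient L (θ t)‖ ^ 2 ≤ -W' t) :
    AverageGradientRate L θ := by
  refine ⟨fun T hT => intervalIntegrable_sq_norm_gradient hC hθ.1 hT.le, fun δ hδ => ?_⟩
  obtain ⟨b, hb⟩ := hLb
  have hb' : ∀ θ, b ≤ L θ := fun θ => hb (mem_range_self θ)
  set B := L (θ 0) + W 0 - b with hB
  have hB0 : 0 ≤ B := by linarith [hb' (θ 0), hW0 0 le_rfl]
  have hl : 0 < Real.log (1 + δ) := Real.log_pos (by linarith)
  -- The first summand serves `T ≥ 1 + δ`. The second serves `T ≤ 1 - δ`, which forces `δ < 1`; for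
  -- larger `δ` it is only some nonnegative number.
  refine ⟨2 * B / Real.log (1 + δ) ^ 2 + C ^ 2 / Real.log (1 - δ) ^ 2 + 1, by positivity,
    fun T hT hTδ => ?_⟩
  set I := ∫ t in (0 : ℝ)..T, ‖gradient L (θ t)‖ ^ 2 with hI
  have hsT : 0 < √T := Real.sqrt_pos.2 hT
  rcases le_abs.1 hTδ with h | h
  · have h1 := integral_sq_norm_gradient_le_of_descent hL hb' hC hθ hW0 hW hgW hT
    rw [← hI, ← hB, stepRatio_of_one_le (by linarith)] at h1
    have h2 : I ≤ 2 * B * √T := by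
      have : 1 / √T / 2 * I = I / (2 * √T) := by field_simp
      rw [this, div_le_iff₀ (by positivity)] at h1
      linarith
    have h3 : Real.log (1 + δ) ^ 2 ≤ Real.log T ^ 2 :=
      pow_le_pow_left₀ hl.le (Real.log_le_log (by linarith) (by linarith)) 2
    calc 1 / T * I ≤ 1 / T * (2 * B * √T) := by gcongr
      _ = 2 * B / √T := by
          have : T = √T * √T := (Real.mul_self_sqrt hT.le).symm
          field_simp
          rw [sq, ← this, mul_comm]
      _ = 2 * B / Real.log (1 + δ) ^ 2 * (Real.log (1 + δ) ^ 2 / √T) := by field_simp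
      _ ≤ 2 * B / Real.log (1 + δ) ^ 2 * (Real.log T ^ 2 / √T) := by gcongr
      _ ≤ _ := by
          refine mul_le_mul_of_nonneg_right ?_ (by positivity)
          have : 0 ≤ C ^ 2 / Real.log (1 - δ) ^ 2 := by positivity
          linarith
  · have hδ1 : 0 < 1 - δ := by linarith
    have hl1 : Real.log (1 - δ) < 0 := Real.log_neg hδ1 (by linarith)
    have h2 : I ≤ C ^ 2 * T := by
      have := intervalIntegral.integral_mono_on hT.le
        (intervalIntegrable_sq_norm_gradient hC hθ.1 hT.le)
        (intervalIntegrable_const (c := C ^ 2)) fun t _ =>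
          pow_le_pow_left₀ (norm_nonneg _) (hC (θ t)) 2
      rw [intervalIntegral.integral_const, sub_zero, smul_eq_mul] at this
      linarith
    have h3 : Real.log (1 - δ) ^ 2 ≤ Real.log T ^ 2 := by
      have h4 : Real.log T ≤ Real.log (1 - δ) := Real.log_le_log hT (by linarith)
      nlinarith
    have h5 : √T ≤ 1 := Real.sqrt_le_one.2 (by linarith)
    have h6 : Real.log (1 - δ) ≠ 0 := hl1.ne
    calc 1 / T * I ≤ 1 / T * (C ^ 2 * T) := by gcongr
      _ = C ^ 2 / Real.log (1 - δ) ^ 2 * (Real.log (1 - δ) ^ 2 / 1) := by field_simp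
      _ ≤ C ^ 2 / Real.log (1 - δ) ^ 2 * (Real.log T ^ 2 / √T) := by gcongr
      _ ≤ _ := by
          refine mul_le_mul_of_nonneg_right ?_ (by positivity)
          have : 0 ≤ 2 * B / Real.log (1 + δ) ^ 2 := by positivity
          linarith

theorem averageGradientRate_of_gradient_error {L : Euc w → ℝ} (hL : Differentiable ℝ L)
    (hLb : BddBelow (range L)) {C : ℝ} (hC : ∀ θ, ‖gradient L θ‖ ≤ C) {θ g : ℝ → Euc w}
    (hθ : SolvesOuter θ g) {A c k a : ℝ} (hc : 0 < c) (ha : 1 ≤ a)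
    (hg : ∀ t, 0 < t → ‖g t - gradient L (θ t)‖ ≤
      A * Real.exp (-c * t) + k * (a + t) ^ (-(1 / 2) : ℝ)) :
    AverageGradientRate L θ := by
  refine averageGradientRate_of_descent hL hLb hC hθ
    -- An explicit primitive: `-W'` equals `A² exp (-2ct) + k² (a + 1)^(1/2) (a + t)^(-3/2)`, which
    -- dominates `ε_t` times the squared error halved.
    (W := fun t => A ^ 2 / (2 * c) * Real.exp (-(2 * c) * t)
      + 2 * k ^ 2 * (a + 1) ^ (1 / 2 : ℝ) * (a + t) ^ (-(1 / 2) : ℝ)) ?_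
    (fun t ht => hasDerivAt_exp_add_rpow _ _ _ _ (by linarith)) ?_
  · intro t ht
    have : 0 ≤ (a + t) ^ (-(1 / 2) : ℝ) := Real.rpow_nonneg (by linarith) _
    positivity
  · intro t ht
    have hat : 0 < a + t := by linarith
    set r := (a + t) ^ (-(1 / 2) : ℝ) with hr
    set s := (a + 1) ^ (1 / 2 : ℝ) with hs
    set x := Real.exp (-c * t) with hx
    have hr0 : 0 < r := Real.rpow_pos_of_pos hat _
    have hε := stepRatio_pos ht
    have e1 : (a + t) ^ (-(3 / 2) : ℝ) = r * r ^ 2 := by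
      rw [hr, ← Real.rpow_two, ← Real.rpow_mul hat.le, ← Real.rpow_add hat]; norm_num
    have e2 : Real.exp (-(2 * c) * t) = x ^ 2 := by
      rw [hx, ← Real.exp_nat_mul]; congr 1; push_cast; ring
    have h1 : ‖g t - gradient L (θ t)‖ ^ 2 ≤ 2 * (A * x) ^ 2 + 2 * (k * r) ^ 2 := by
      refine (pow_le_pow_left₀ (norm_nonneg _) (hg t ht) 2).trans ?_
      nlinarith [sq_nonneg (A * x - k * r)]
    have h2 : stepRatio t * (A * x) ^ 2 ≤ (A * x) ^ 2 :=
      mul_le_of_le_one_left (sq_nonneg _) (stepRatio_le_one t)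
    have h3 : stepRatio t * (k * r) ^ 2 ≤ s * r * (k * r) ^ 2 :=
      mul_le_mul_of_nonneg_right (stepRatio_le_mul_rpow ha ht) (sq_nonneg _)
    rw [e1, e2]
    calc stepRatio t / 2 * ‖g t - gradient L (θ t)‖ ^ 2
        ≤ stepRatio t / 2 * (2 * (A * x) ^ 2 + 2 * (k * r) ^ 2) := by gcongr
      _ = stepRatio t * (A * x) ^ 2 + stepRatio t * (k * r) ^ 2 := by ring
      _ ≤ (A * x) ^ 2 + s * r * (k * r) ^ 2 := add_le_add h2 h3
      _ = _ := by field_simp; ring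

end Descent

/-! ### Gradient formula and convergence rate. -/

theorem mainTheorem4 {p d w q : ℕ}
    -- the model: divergence, equilibrium map, readout with its first variation, loss, data
    (D : P2 p → P2 p → ℝ) (F : Euc w → P2 p → P2 d → P2 p)
    (h : P2 p → Euc q) (dh : P2 p → Euc p → Euc q) (ℓ : Euc q → Euc q → ℝ)
    (P : MeasureTheory.Measure (P2 d × Euc q)) [MeasureTheory.IsProbabilityMeasure P]
    (hD : IsSymmDivergence D)
    (hDcont : ∀ μ ν, DivContinuousAt D μ ν)
    (hh : ∀ μ, HasFirstVariation h μ (dh μ))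
    (hℓ : ∀ y, Differentiable ℝ (fun u => ℓ u y))
    -- solutions of the inner problem
    (μstar : Euc w → P2 d → P2 p)
    (hmin : ∀ θ ρ, IsMinOn (innerObj D F θ ρ) Set.univ (μstar θ ρ))
    -- the outer loss is well defined and bounded below
    (hLint : ∀ θ, MeasureTheory.Integrable (fun z => ℓ (h (μstar θ z.1)) z.2) P)
    (hLbdd : BddBelow (Set.range (outerLoss P ℓ h μstar)))
    -- Gibbs form of the solutions of the inner problem
    (V : P2 d → Euc p → Euc w → ℝ) (C_V : ℝ)
    (hV : ∀ ρ, ContDiff ℝ 1 (fun xθ : Euc p × Euc w => V ρ xθ.1 xθ.2))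
    (hVbd : ∀ ρ x θ, ‖gradTheta V ρ θ x‖ ≤ C_V)
    (hGibbs : ∀ θ ρ, ∃ Z : ℝ, 0 < Z ∧ (μstar θ ρ).1 =
      MeasureTheory.volume.withDensity (fun x => ENNReal.ofReal (Real.exp (-V ρ x θ) / Z)))
    -- Lipschitz continuity and boundedness of `Γ`
    (K_Γ C_Γ : ℝ)
    (hΓ : ∀ᵐ z ∂P, ∀ θ μ ν,
      ‖plugGrad ℓ h dh V z μ θ - plugGrad ℓ h dh V z ν θ‖ ≤ K_Γ * D μ ν ∧
      ‖plugGrad ℓ h dh V z μ θ‖ ≤ C_Γ)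
    -- Polyak-Lojasiewicz inequality
    (C_PL : ℝ) (hC_PL : 0 ≤ C_PL)
    (hPL : ∀ θ ρ μ ξ, HasWGradient (fun μ' => D μ' (μstar θ ρ)) μ ξ →
      D μ (μstar θ ρ) ≤ C_PL * ∫ x, ‖ξ x‖ ^ 2 ∂μ.1) :
    Differentiable ℝ (outerLoss P ℓ h μstar) ∧
    (∀ θ, gradient (outerLoss P ℓ h μstar) θ = ∫ z, plugGrad ℓ h dh V z (μstar θ z.1) θ ∂P) ∧
    ∀ (θ : ℝ → Euc w) (μ : P2 d → ℝ → P2 p) (v : P2 d → ℝ → Euc p → Euc p) (C_F M : ℝ),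
      -- inner dynamics
      (∀ ρ, IsWGradientFlow (fun t => innerObj D F (θ t) ρ) (μ ρ) (v ρ)) →
      -- differentiability along the dynamics, with bounded first variation
      (∀ ρ t, 0 ≤ t → D (μ ρ t) (μstar (θ t) ρ) ≠ 0 →
        ∃ ξ φ, HasDivDerivAt D (μ ρ t) (μstar (θ t) ρ) ξ φ ∧
          MeasureTheory.eLpNorm φ 2 (μstar (θ t) ρ).1 ≤ ENNReal.ofReal C_F) →
      -- control of the gradient mismatch
      0 < M →
      (∀ ρ, ∀ᵐ t ∂(MeasureTheory.volume.restrict (Set.Ioi (0 : ℝ))),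
        D (μ ρ t) (μstar (θ t) ρ) ≠ 0 →
        ∀ ξ, HasWGradient (fun μ' => D μ' (μstar (θ t) ρ)) (μ ρ t) ξ →
          ∫ x, ‖-v ρ t x - ξ x‖ ^ 2 ∂(μ ρ t).1 ≤ M * stepRatio t) →
      -- outer dynamics driven by the gradient of the loss
      (SolvesOuter θ (fun t => gradient (outerLoss P ℓ h μstar) (θ t)) →
        AverageGradientRate (outerLoss P ℓ h μstar) θ) ∧
      -- outer dynamics driven by the gradient computed from the current inner state
      (SolvesOuter θ (fun t => ∫ z, plugGrad ℓ h dh V z (μ z.1 t) (θ t) ∂P) →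
        (∀ t, 0 < t → MeasureTheory.AEStronglyMeasurable
          (fun z => plugGrad ℓ h dh V z (μ z.1 t) (θ t)) P) →
        MeasureTheory.Integrable (fun z => D (μ z.1 0) (μstar (θ 0) z.1)) P →
        AverageGradientRate (outerLoss P ℓ h μstar) θ) := by
  have hgibbs : ∀ ρ, IsGibbsFamily (V ρ) (fun θ => μstar θ ρ) := fun ρ θ => hGibbs θ ρ
  have hsample : ∀ (z : P2 d × Euc q) θ, HasGradientAt (fun θ => ℓ (h (μstar θ z.1)) z.2)
      (plugGrad ℓ h dh V z (μstar θ z.1) θ) θ := fun z θ =>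
    (hgibbs z.1).hasGradientAt_loss (hV z.1) (fun x θ => hVbd z.1 x θ) θ (hh _) (hℓ z.2)
  have hbound : ∀ᵐ z ∂P, ∀ θ, ‖plugGrad ℓ h dh V z (μstar θ z.1) θ‖ ≤ C_Γ :=
    hΓ.mono fun z hz θ => (hz θ _ (μstar θ z.1)).2
  have houter := hasGradientAt_integral_of_bounded hLint hsample hbound
  have hC_Γ : 0 ≤ C_Γ := by
    obtain ⟨z, hz⟩ := hbound.exists
    exact (norm_nonneg _).trans (hz 0)
  have hdiffL : Differentiable ℝ (outerLoss P ℓ h μstar) := fun θ =>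
    (houter θ).2.differentiableAt
  have hgrad : ∀ θ, gradient (outerLoss P ℓ h μstar) θ =
      ∫ z, plugGrad ℓ h dh V z (μstar θ z.1) θ ∂P := fun θ => (houter θ).2.gradient
  have hgradle : ∀ θ, ‖gradient (outerLoss P ℓ h μstar) θ‖ ≤ C_Γ := fun θ => by
    rw [hgrad]
    simpa using norm_integral_le_of_norm_le_const (hbound.mono fun z hz => hz θ)
  refine ⟨hdiffL, hgrad, fun θ μ v C_F M hflow hdiff hM hmis => ⟨fun hθ => ?_, ?_⟩⟩
  · exact averageGradientRate_of_gradient_error hdiffL hLbdd hgradle hθ (A := 0) (c := 1) (k := 0)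
      (a := 1) one_pos le_rfl (by simp)
  · intro hθ hmeas hD0
    set g : ℝ → Euc w := fun t => ∫ z, plugGrad ℓ h dh V z (μ z.1 t) (θ t) ∂P with hg
    have hgle : ∀ t, ‖g t‖ ≤ C_Γ := fun t => by
      simpa using norm_integral_le_of_norm_le_const (μ := P)
        (hΓ.mono fun z hz => (hz (θ t) (μ z.1 t) (μ z.1 t)).2)
    have hθ'le : ∀ t, 0 < t → ‖-(stepRatio t • g t)‖ ≤ C_Γ * stepRatio t := fun t ht => by
      rw [norm_neg, norm_smul, Real.norm_of_nonneg (stepRatio_pos ht).le, mul_comm]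
      exact mul_le_mul_of_nonneg_right (hgle t) (stepRatio_pos ht).le
    set c := 1 / (2 * (C_PL + 1)) with hc
    have hc0 : 0 < c := by positivity
    set a := 1 + 1 / c with ha
    have hac : 0 < 1 / c := by positivity
    set k := decayAmplitude c (M / 2 + 2 * C_V * C_Γ * max C_F 0) with hk
    -- The constants are uniform in `ρ`, only the initial divergence varies. The expectation is thus
    -- taken of this bound, and integrability of the divergence is needed only at time `0`.
    have hdecay : ∀ ρ t, 0 ≤ t → D (μ ρ t) (μstar (θ t) ρ) ≤
        D (μ ρ 0) (μstar (θ 0) ρ) * Real.exp (-c * t) + k * (a + t) ^ (-(1 / 2) : ℝ) :=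
      fun ρ t ht => div_le_exp_add_rpow_of_flow hD.nonneg hDcont (hV ρ)
        (fun x θ => hVbd ρ x θ) (hgibbs ρ) hC_Γ hθ.1 hθ.2 hθ'le (hflow ρ) (hdiff ρ) hM (hmis ρ)
        hC_PL (fun θ μ ξ => hPL θ ρ μ ξ) ht
    refine averageGradientRate_of_gradient_error hdiffL hLbdd hgradle hθ
      (A := |K_Γ| * ∫ z, D (μ z.1 0) (μstar (θ 0) z.1) ∂P) (c := c) (k := |K_Γ| * k) (a := a)
      hc0 (by linarith) fun t ht => ?_
    have i1 : Integrable (fun z => plugGrad ℓ h dh V z (μ z.1 t) (θ t)) P :=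
      Integrable.of_bound (hmeas t ht) C_Γ
        (hΓ.mono fun z hz => (hz (θ t) (μ z.1 t) (μ z.1 t)).2)
    rw [hgrad, hg, ← integral_sub i1 (houter (θ t)).1]
    have i2 : Integrable (fun z => |K_Γ| * (D (μ z.1 0) (μstar (θ 0) z.1) * Real.exp (-c * t)
        + k * (a + t) ^ (-(1 / 2) : ℝ))) P :=
      ((hD0.mul_const _).add (integrable_const _)).const_mul _
    refine (norm_integral_le_of_norm_le i2 (hΓ.mono fun z hz => ?_)).trans (le_of_eq ?_)
    · calc _ ≤ K_Γ * D (μ z.1 t) (μstar (θ t) z.1) := (hz (θ t) _ _).1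
        _ ≤ |K_Γ| * D (μ z.1 t) (μstar (θ t) z.1) :=
            mul_le_mul_of_nonneg_right (le_abs_self _) (hD.nonneg _ _)
        _ ≤ _ := mul_le_mul_of_nonneg_left (hdecay z.1 t ht.le) (abs_nonneg _)
    · rw [integral_const_mul, integral_add (hD0.mul_const _) (integrable_const _),
        integral_mul_const]
      simp
      ring
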